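/- Let $r\ge 1$ and let $p_1=0,p_2,\dots,p_{r+1}$ be Laurent series in $t$ with complex coefficients and finitely many negative exponents, convergent for $0<|t|$ small. Write $d(p)$ for the lowest exponent of $p$ with nonzero coefficient, and write $q<p$ if $p\ne q$ and the coefficient of $q$ at the exponent $d(p-q)$ is zero. Assume $p_1<p_2<\cdots<p_{r+1}$. For small $t\neq 0$ let $C_t\subset\mathbb P^{r+1}$ be the line $X_1+X_i-p_i(t)=0$ ($2\le i\le r+1$), with the affine coordinate $\zeta=X_1$ and marked at its intersections $\zeta=p_1(t),\dots,p_{r+1}(t),\infty$ with the toric divisors. Let $(\Gamma_v,h_v)$ be a $3$-valent embedded tropical curve in $\mathbb R^{r+1}$, with all edge weights $1$, whose image is the tropicalization of the line, i.e. the intersection of the tropical hyperplanes given by the $(\min,+)$-polynomials $X_i\oplus X_j\oplus d(p_i-p_j)$, $i\neq j$, which tropicalize the equations $X_1+X_j-p_j=0$ and $X_i-X_j-p_i+p_j=0$ of the line. Its unbounded edges have the directions $e_1,\dots,e_{r+1}$ and $f=-\sum_j e_j$. Let $D$ be a pre-log curve of type $(\Gamma_v,h_v)$: a nodal curve with one component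 $\mathbb P^1$ for each vertex, with a marked point for each edge at that vertex, the two points of each bounded edge being glued to a node, together with torically transverse maps of the components which meet precisely the toric divisors of the adjacent edges, at the marked points and with multiplicity the weight, and which agree at the nodes. For such a marked curve $C$ with toric coordinates $X_1,\dots,X_{r+1}$, let $\Gamma(C,\mathcal N^\vee\otimes\omega)$ be the complex vector space of local dual obstruction sections, where $\mathcal N=(N\otimes\mathcal O_C)/\Theta_C$ is the log normal sheaf, $N=\mathbb Z^{r+1}$, and all marked points are treated as nodes of an ambient curve: its elements are the families $\sum_i e_i^\vee\otimes\omega_i$ of $N^\vee_{\mathbb C}$-valued meromorphic $1$-forms on the components, with at most logarithmic poles at the marked points and no other poles, with opposite residues on the two branches of each node inside $C$, and with $\sum_i\omega_i\otimes d\log X_i=0$ on each component. Then there is $\varepsilon>0$ such that for all $0<|t|<\varepsilon$ there are (non-canonical) linear isomorphisms $$\Theta_t\colon \Gamma(D,\mathcal N^\vee\otimes\omega)\xrightarrow{\ \sim\ }\Gamma(C_t,\mathcal N^\vee\otimes\omega),$$ which can be chosen to be compatible with residues modulo terms of order $t$: for every section $s$ of the left hand side there is a constant $K$ such that for all $0<|t|<\varepsilon$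 and for each direction $e_j$ (respectively $f$), each component of the $N^\vee_{\mathbb C}$-valued residue of $\Theta_t(s)$ at $\zeta=p_j(t)$ (respectively $\zeta=\infty$) differs by at most $K|t|$ from the corresponding component of the residue of $s$ at the marked point of the unbounded edge of $\Gamma_v$ of that direction. -/

import Mathlib

open scoped OnePoint RatFunc

noncomputable section

namespace TropLine

/-! ### Convergent Laurent series and their partial order -/

/-- The Laurent series `q` converges on some punctured disc around `0`. -/
def Converges (q : LaurentSeries ℂ) : Prop :=
  ∃ ε : ℝ, 0 < ε ∧ ∀ t : ℂ, 0 < ‖t‖ → ‖t‖ < ε → Summable fun k : ℤ => q.coeff k * t ^ k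

/-- The value of a convergent Laurent series at a small nonzero `t`. -/
def value (q : LaurentSeries ℂ) (t : ℂ) : ℂ := ∑' k : ℤ, q.coeff k * t ^ k

/-- `Prec q p` means `q < p`: at the lowest exponent where `p` and `q` differ, the coefficient
of `q` vanishes (so the lowest order term of `p - q` is a term of `p`). -/
def Prec (q p : LaurentSeries ℂ) : Prop :=
  ∃ j : ℤ, (∀ k < j, p.coeff k = q.coeff k) ∧ p.coeff j ≠ 0 ∧ q.coeff j = 0

/-! ### Tropicalization of the line `X₁ + Xᵢ - pᵢ = 0` -/

/-- The minimum of three real numbers is attained at least twice. -/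
def MinAttainedTwice (a b c : ℝ) : Prop :=
  (a = b ∧ a ≤ c) ∨ (a = c ∧ a ≤ b) ∨ (b = c ∧ b ≤ a)

/-- The tropicalization of the line `X_0 + X_i = p_i` (`i ≥ 1`, with `p_0 = 0`), `(min, +)`
convention: the intersection of the tropical hyperplanes `X_i ⊕ X_j ⊕ d(p_i - p_j)` of the
three-term equations `X_0 + X_j - p_j = 0` and `X_i - X_j - p_i + p_j = 0` of the line. -/
def tropLine {m : ℕ} (p : Fin m → LaurentSeries ℂ) : Set (Fin m → ℝ) :=
  {x | ∀ i j, i ≠ j → MinAttainedTwice (x i) (x j) ((p i - p j).order : ℝ)}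

/-! ### Graphs with unbounded edges, and tropical curves -/

/-- A graph with unbounded edges, given by its vertices `V` and its flags `F`. The flag `f` sits at
the vertex `vert f`; if `opp f ≠ f`, then `f` and `opp f` are the two flags of a bounded edge, and if
`opp f = f`, then `f` is the flag of an unbounded edge. -/
structure FlagGraph (V F : Type*) where
  vert : F → V
  opp : F → F
  opp_opp : ∀ f, opp (opp f) = f

open Classical in
/-- A parametrized tropical curve in `ℝⁿ` none of whose edges is contracted: vertices `v` are
placed at `pos v`, the edge of the flag `f` leaves `pos (vert f)` in the primitive integral direction
`dir f`, has weight `wt f`, and, if it is bounded, has lattice length `len f`. -/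
structure TropicalCurve (n : ℕ) (V F : Type*) [Fintype V] [Fintype F] extends FlagGraph V F where
  connected : ∀ v w : V,
    Relation.ReflTransGen (fun a b => ∃ f, vert f = a ∧ vert (opp f) = b) v w
  pos : V → Fin n → ℝ
  pos_rational : ∀ v i, ∃ q : ℚ, pos v i = (q : ℝ)
  dir : F → Fin n → ℤ
  dir_primitive : ∀ f, Finset.univ.gcd (dir f) = 1
  wt : F → ℕ
  wt_pos : ∀ f, 0 < wt f
  wt_opp : ∀ f, wt (opp f) = wt f
  len : F → ℝ
  len_pos : ∀ f, opp f ≠ f → 0 < len f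
  dir_opp : ∀ f, opp f ≠ f → ∀ i, dir (opp f) i = - dir f i
  pos_opp : ∀ f, opp f ≠ f → ∀ i, pos (vert (opp f)) i = pos (vert f) i + len f * (dir f i : ℝ)
  balanced : ∀ (v : V) (i : Fin n),
    ∑ f with vert f = v, (wt f : ℤ) * dir f i = 0

namespace TropicalCurve

variable {n : ℕ} {V F : Type*} [Fintype V] [Fintype F]

/-- The image in `ℝⁿ` of the interior of the edge of the flag `f` (an open segment for a bounded
edge, an open ray for an unbounded one). -/
def openEdge (Γ : TropicalCurve n V F) (f : F) : Set (Fin n → ℝ) :=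
  {x | ∃ s : ℝ, 0 < s ∧ (Γ.opp f ≠ f → s < Γ.len f) ∧
    ∀ i, x i = Γ.pos (Γ.vert f) i + s * (Γ.dir f i : ℝ)}

/-- The image of the tropical curve in `ℝⁿ`. -/
def image (Γ : TropicalCurve n V F) : Set (Fin n → ℝ) :=
  Set.range Γ.pos ∪ ⋃ f, Γ.openEdge f

/-- The parametrization of the tropical curve is injective. -/
def IsEmbedded (Γ : TropicalCurve n V F) : Prop :=
  Function.Injective Γ.pos ∧
  (∀ v f, Γ.pos v ∉ Γ.openEdge f) ∧
  (∀ f g, g ≠ f → g ≠ Γ.opp f → Disjoint (Γ.openEdge f) (Γ.openEdge g))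

/-- Every vertex has exactly three flags. -/
def IsTrivalent (Γ : TropicalCurve n V F) : Prop :=
  ∀ v, Nat.card {f : F // Γ.vert f = v} = 3

end TropicalCurve

/-! ### Rational functions and rational one-forms on the projective line

The projective line is `OnePoint ℂ`, with affine coordinate `z` and with local coordinate
`w = 1 / z` at `∞`. The one-form `f dz` is represented by the rational function `f`. -/

lemma aeval_inv_X_injective :
    Function.Injective (Polynomial.aeval (R := ℂ) ((RatFunc.X : RatFunc ℂ)⁻¹)) := by
  rw [← transcendental_iff_injective]
  intro h
  exact RatFunc.transcendental_X (K := ℂ) (by simpa using h.inv)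

/-- The substitution `f(z) ↦ f(1/z)`. -/
def invSubst : RatFunc ℂ →ₐ[ℂ] RatFunc ℂ :=
  RatFunc.liftAlgHom (Polynomial.aeval (R := ℂ) ((RatFunc.X : RatFunc ℂ)⁻¹))
    (nonZeroDivisors_le_comap_nonZeroDivisors_of_injective _ aeval_inv_X_injective)

/-- The Laurent expansion of a rational function at a point of the projective line, in the local
coordinate `z - a` at `a` and `1 / z` at `∞`. -/
def expand : OnePoint ℂ → RatFunc ℂ →+* LaurentSeries ℂ
  | ∞ => (algebraMap (RatFunc ℂ) (LaurentSeries ℂ)).comp invSubst.toRingHom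
  | OnePoint.some a => (algebraMap (RatFunc ℂ) (LaurentSeries ℂ)).comp (RatFunc.laurent a).toRingHom

/-- The Laurent expansion of the one-form `f dz` at a point: the series `g` with
`f dz = g(s) ds` in the local coordinate `s`; at `∞`, `f(z) dz = - w⁻² f(1/w) dw`. -/
def expandForm : OnePoint ℂ → RatFunc ℂ → LaurentSeries ℂ
  | ∞, f => expand ∞ (-RatFunc.X ^ 2 * f)
  | OnePoint.some a, f => expand (OnePoint.some a) f

lemma algebraMap_C_laurent (c : ℂ) :
    algebraMap (RatFunc ℂ) (LaurentSeries ℂ) (RatFunc.C c) = HahnSeries.C c := by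
  rw [← RatFunc.algebraMap_C, ← IsScalarTower.algebraMap_apply (Polynomial ℂ) (RatFunc ℂ)
    (LaurentSeries ℂ)]
  simp

lemma expand_C (x : OnePoint ℂ) (c : ℂ) : expand x (RatFunc.C c) = HahnSeries.C c := by
  induction x using OnePoint.rec with
  | infty =>
    have h : invSubst (RatFunc.C c) = RatFunc.C c := invSubst.commutes c
    simp [expand, h, algebraMap_C_laurent]
  | coe a => simp [expand, algebraMap_C_laurent]

lemma expandForm_zero (x : OnePoint ℂ) : expandForm x 0 = 0 := by
  induction x using OnePoint.rec with
  | infty => simp [expandForm]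
  | coe a => simp [expandForm]

lemma expandForm_add (x : OnePoint ℂ) (f g : RatFunc ℂ) :
    expandForm x (f + g) = expandForm x f + expandForm x g := by
  induction x using OnePoint.rec with
  | infty => simp only [expandForm, mul_add, map_add]
  | coe a => simp only [expandForm, map_add]

lemma expandForm_smul (x : OnePoint ℂ) (c : ℂ) (f : RatFunc ℂ) :
    expandForm x (c • f) = c • expandForm x f := by
  rw [RatFunc.smul_eq_C_mul, ← HahnSeries.C_mul_eq_smul, ← expand_C x c]
  induction x using OnePoint.rec with
  | infty => simp only [expandForm, map_mul]; ring
  | coe a => simp only [expandForm, map_mul]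

/-- The residue of the one-form `f dz` at the point `x`. -/
def residue (x : OnePoint ℂ) (f : RatFunc ℂ) : ℂ := (expandForm x f).coeff (-1)

/-- The logarithmic derivative `g' / g` of a rational function `g`. -/
def dlog (g : RatFunc ℂ) : RatFunc ℂ :=
  algebraMap (Polynomial ℂ) (RatFunc ℂ) (Polynomial.derivative g.num) /
      algebraMap (Polynomial ℂ) (RatFunc ℂ) g.num -
    algebraMap (Polynomial ℂ) (RatFunc ℂ) (Polynomial.derivative g.denom) /
      algebraMap (Polynomial ℂ) (RatFunc ℂ) g.denom

/-! ### Nodal curves with rational components and their dual obstruction sections -/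

/-- A nodal curve with components `ℙ¹` indexed by the vertices of a graph, together with a map
to the toric varieties of the lattice `N = ℤⁿ` on each component. The flag `f` marks the point
`pt f` of the component `vert f`; the two flags of a bounded edge are glued to a node. On the
component `v` the toric coordinate `X_i` (the character `e_i^∨`) pulls back to `coord v i`. -/
structure ToricCurve (n : ℕ) {V F : Type*} (G : FlagGraph V F) where
  pt : F → OnePoint ℂ
  coord : V → Fin n → RatFunc ℂ

namespace ToricCurve

variable {n : ℕ} {V F : Type*}

/-- Global sections of `𝒩^∨ ⊗ ω`, where `𝒩 = (N ⊗ 𝒪) / Θ` is the logarithmic normal sheaf.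
Since `𝒩^∨` is the kernel of `N^∨ ⊗ 𝒪 → Θ^∨`, `e_i^∨ ↦ d log X_i`, such a section is an
`N^∨`-valued one-form `∑ e_i^∨ ⊗ ω_{v,i}` on every component `v` which is regular away from the
marked points, has at most logarithmic poles at the marked points, has opposite residues on the two
branches of every node, and annihilates the logarithmic tangent vectors of the curve:
`∑ ω_{v,i} ⊗ d log X_i = 0`. The points of the unbounded edges are also allowed to be poles, as
these edges are part of bounded edges of an ambient tropical curve and hence nodes of the whole
curve. -/
def dualObstructionSections {G : FlagGraph V F} (D : ToricCurve n G) :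
    Submodule ℂ (V → Fin n → RatFunc ℂ) where
  carrier := {ω |
    (∀ v i x, (∀ f, G.vert f = v → D.pt f ≠ x) → ∀ k < (0 : ℤ), (expandForm x (ω v i)).coeff k = 0) ∧
    (∀ f i, ∀ k < (-1 : ℤ), (expandForm (D.pt f) (ω (G.vert f) i)).coeff k = 0) ∧
    (∀ f, G.opp f ≠ f → ∀ i,
      residue (D.pt f) (ω (G.vert f) i) + residue (D.pt (G.opp f)) (ω (G.vert (G.opp f)) i) = 0) ∧
    (∀ v, ∑ i, ω v i * dlog (D.coord v i) = 0)}
  zero_mem' := by simp [residue, expandForm_zero]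
  add_mem' := by
    rintro a b ⟨ha1, ha2, ha3, ha4⟩ ⟨hb1, hb2, hb3, hb4⟩
    refine ⟨?_, ?_, ?_, ?_⟩
    · intro v i x hx k hk
      simp [expandForm_add, ha1 v i x hx k hk, hb1 v i x hx k hk]
    · intro f i k hk
      simp [expandForm_add, ha2 f i k hk, hb2 f i k hk]
    · intro f hf i
      have h1 := ha3 f hf i
      have h2 := hb3 f hf i
      simp only [residue, Pi.add_apply, expandForm_add, HahnSeries.coeff_add] at h1 h2 ⊢
      linear_combination h1 + h2
    · intro v
      simp [add_mul, Finset.sum_add_distrib, ha4 v, hb4 v]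
  smul_mem' := by
    rintro c a ⟨ha1, ha2, ha3, ha4⟩
    refine ⟨?_, ?_, ?_, ?_⟩
    · intro v i x hx k hk
      simp [expandForm_smul, ha1 v i x hx k hk]
    · intro f i k hk
      simp [expandForm_smul, ha2 f i k hk]
    · intro f hf i
      have h1 := ha3 f hf i
      simp only [residue, Pi.smul_apply, expandForm_smul, HahnSeries.coeff_smul, smul_eq_mul] at h1 ⊢
      linear_combination c * h1
    · intro v
      simp [← Finset.smul_sum, ha4 v]

/-- `D` is a pre-log curve of type `Γ`: on every component the marked points are distinct; the
component `v` is a torically transverse curve meeting exactly the toric divisors of the flags `f`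
at `v`, at the point `pt f` and with multiplicity the weight of `f` (so the character `e_i^∨` has
order `wt f * ⟨e_i^∨, dir f⟩` there, and neither zeros nor poles elsewhere); and the maps on the two
branches of a node agree there, i.e. the characters of the torus of the common toric divisor (those
annihilating `dir f`) take the same value on the two branches. -/
structure IsPreLogOfType [Fintype V] [Fintype F] (Γ : TropicalCurve n V F)
    (D : ToricCurve n Γ.toFlagGraph) : Prop where
  pt_injective : ∀ f g, Γ.vert f = Γ.vert g → D.pt f = D.pt g → f = g
  coord_ne_zero : ∀ v i, D.coord v i ≠ 0
  order_marked : ∀ f i, (expand (D.pt f) (D.coord (Γ.vert f) i)).order = (Γ.wt f : ℤ) * Γ.dir f i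
  order_unmarked : ∀ v i x, (∀ f, Γ.vert f = v → D.pt f ≠ x) →
    (expand x (D.coord v i)).order = 0
  node_agree : ∀ f, Γ.opp f ≠ f → ∀ m : Fin n → ℤ, ∑ i, m i * Γ.dir f i = 0 →
    (expand (D.pt f) (∏ i, D.coord (Γ.vert f) i ^ m i)).coeff 0 =
      (expand (D.pt (Γ.opp f)) (∏ i, D.coord (Γ.vert (Γ.opp f)) i ^ m i)).coeff 0

end ToricCurve

/-! ### The line in projective space -/

/-- One vertex with `r + 2` unbounded edges: `some j` for the direction `e_j`, and `none` for the
direction `- ∑ e_j`. -/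
def starGraph (r : ℕ) : FlagGraph Unit (Option (Fin (r + 1))) where
  vert := fun _ => ()
  opp := id
  opp_opp := fun _ => rfl

/-- The directions of the unbounded edges of the one-vertex tropical line in `ℝ^{r+1}`. -/
def starDir (r : ℕ) : Option (Fin (r + 1)) → Fin (r + 1) → ℤ
  | none => fun _ => -1
  | some j => Pi.single j 1

/-- The line `X_0 + X_i = p_i(t)`, `i ≥ 1`, in `ℙ^{r+1}`, with the affine coordinate `z = X_0`; it
meets the toric divisors `X_j = 0` at `z = p_j(t)` (with `p_0 = 0`) and the divisor at infinity at
`z = ∞`. -/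
def lineCurve {r : ℕ} (p : Fin (r + 1) → LaurentSeries ℂ) (t : ℂ) :
    ToricCurve (r + 1) (starGraph r) where
  pt
    | none => ∞
    | some j => OnePoint.some (value (p j) t)
  coord := fun _ i => if i = 0 then RatFunc.X else RatFunc.C (value (p i) t) - RatFunc.X

end TropLine

end

noncomputable section

namespace TropLine

/-! ### Orders of vanishing of Laurent series -/

/-! Put n = r + 1 and record a family of forms by the matrix R, where R j i is the residue of ω_i at
the marked point of direction e_j. A form on ℙ¹ with logarithmic poles at given points is determined
by its residues, and these are constrained only by having sum zero. Both spaces of sections thus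
become spaces of n × n matrices, and what remains is to compare the linear conditions coming from ∑
ω_i d log X_i = 0.

On the line, d log X_i = dz / (z - p_i). The quadratic differential vanishes exactly when its double
poles do, R j j = 0, and when the sums c_j = ∑_i (R i j + R j i) / (p_j - p_i) vanish
(`quadratic_eta_eq_zero_iff`).

The tropical curve is the rooted tree of clusters of the series p_i. At each vertex v one flag
points down, towards infinity, and two flags point up, towards disjoint clusters K_v and L_v of
indices (`nonempty_fork`). Since residues are balanced along the tree, the residue of ω_i at a flag
f is ∑_j dir f j * R j i (`balanced_eq_sum_dir`). On a component with three marked points the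
quadratic condition reduces to one equation per flag, and over the whole tree these equations amount
to R j j = 0 together with the vanishing of the sum of R i j + R j i over K_v × L_v for each v
(`exists_sections_equiv`, `quadratic_dir_eq_zero_iff`).

To compare the two, sum c_j over j in K_v. Pairs inside K_v cancel. After multiplication by p_k -
p_l, with k in K_v and l in L_v fixed, the coefficient of a remaining pair (j, i) is 1 + O(t) if i
lies in L_v and O(t) otherwise (`exists_ratio_bound`). Nothing is lost by passing to these sums
(`mem_ker_lineWeight_iff`). So the matrices of the line form the kernel of a perturbation of order t
of the map whose kernel describes D. The limit map has a right inverse, because a pair of indices is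
separated at no more than one vertex (`conditionMap_conditionSection`), and then the kernels are
isomorphic by maps that are the identity up to O(t) (`exists_ker_equiv`). -/

/-- All coefficients of `A` at exponents below `n` vanish. -/
def VanishBelow (n : ℤ) (A : LaurentSeries ℂ) : Prop := ∀ k < n, A.coeff k = 0

namespace VanishBelow

variable {m n : ℤ} {A B : LaurentSeries ℂ}

lemma iff_le_orderTop : VanishBelow n A ↔ (n : WithTop ℤ) ≤ A.orderTop := by
  rw [HahnSeries.le_orderTop_iff_forall]
  simp [VanishBelow]

lemma mono (h : VanishBelow n A) (hmn : m ≤ n) : VanishBelow m A :=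
  fun k hk => h k (hk.trans_le hmn)

lemma zero : VanishBelow n 0 := fun _ _ => rfl

lemma add (hA : VanishBelow n A) (hB : VanishBelow n B) : VanishBelow n (A + B) :=
  fun k hk => by simp [hA k hk, hB k hk]

lemma sub (hA : VanishBelow n A) (hB : VanishBelow n B) : VanishBelow n (A - B) :=
  fun k hk => by simp [hA k hk, hB k hk]

lemma neg (hA : VanishBelow n A) : VanishBelow n (-A) :=
  fun k hk => by simp [hA k hk]

lemma smul (c : ℂ) (hA : VanishBelow n A) : VanishBelow n (c • A) :=
  fun k hk => by simp [hA k hk]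

lemma sum {ι : Type*} (s : Finset ι) {f : ι → LaurentSeries ℂ}
    (h : ∀ i ∈ s, VanishBelow n (f i)) : VanishBelow n (∑ i ∈ s, f i) := by
  intro k hk
  rw [HahnSeries.coeff_sum]
  exact Finset.sum_eq_zero fun i hi => h i hi k hk

lemma mul (hA : VanishBelow m A) (hB : VanishBelow n B) : VanishBelow (m + n) (A * B) := by
  rw [iff_le_orderTop] at *
  rw [HahnSeries.orderTop_mul, WithTop.coe_add]
  exact add_le_add hA hB

lemma single (c : ℂ) : VanishBelow n (HahnSeries.single n c) :=
  fun _ hk => HahnSeries.coeff_single_of_ne hk.ne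

lemma of_order (h : n ≤ A.order) : VanishBelow n A :=
  fun _ hk => HahnSeries.coeff_eq_zero_of_lt_order (hk.trans_le h)

lemma sub_single (hA : VanishBelow n A) :
    VanishBelow (n + 1) (A - HahnSeries.single n (A.coeff n)) := by
  intro k hk
  rcases (Int.lt_add_one_iff.mp hk).lt_or_eq with h | rfl
  · rw [HahnSeries.coeff_sub, hA k h, HahnSeries.coeff_single_of_ne h.ne, sub_zero]
  · simp

/-- Replacing a factor by its leading monomial changes the product only at exponents above `m + n`.
-/
lemma coeff_mul (hA : VanishBelow m A) (hB : VanishBelow n B) :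
    (A * B).coeff (m + n) = A.coeff m * B.coeff n := by
  have h1 := (hA.sub_single.mul hB) (m + n) (by lia)
  have h2 := ((single (n := m) (A.coeff m)).mul hB.sub_single) (m + n) (by lia)
  rw [sub_mul, HahnSeries.coeff_sub] at h1
  rw [mul_sub, HahnSeries.coeff_sub, HahnSeries.single_mul_single, HahnSeries.coeff_single_same]
    at h2
  linear_combination h1 + h2

lemma eq_order (hA : VanishBelow n A) (h : A.coeff n ≠ 0) : A.order = n := by
  refine le_antisymm (HahnSeries.order_le_of_coeff_ne_zero h) ?_
  by_contra! hlt
  have hne : A ≠ 0 := by rintro rfl; simp at h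
  exact HahnSeries.coeff_order_eq_zero.not.mpr hne (hA _ hlt)

end VanishBelow

/-! ### Expansions of polynomials -/

local notation "ι" => algebraMap (Polynomial ℂ) (RatFunc ℂ)

lemma expand_coe_polynomial (a : ℂ) (P : Polynomial ℂ) :
    expand (OnePoint.some a) (ι P) =
      HahnSeries.ofPowerSeries ℤ ℂ ((Polynomial.taylor a P : Polynomial ℂ) : PowerSeries ℂ) := by
  have : expand (OnePoint.some a) (ι P) =
    algebraMap (RatFunc ℂ) (LaurentSeries ℂ) (RatFunc.laurent a (ι P)) := rfl
  rw [this, RatFunc.laurent_algebraMap, RatFunc.coe_coe]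
  rfl

lemma vanishBelow_ofPowerSeries (Q : PowerSeries ℂ) :
    VanishBelow 0 (HahnSeries.ofPowerSeries ℤ ℂ Q) := by
  intro k hk
  rw [HahnSeries.ofPowerSeries_apply]
  apply HahnSeries.embDomain_of_notMem_range
  rintro ⟨n, rfl⟩
  exact absurd hk (not_lt.mpr (Int.natCast_nonneg n))

lemma vanishBelow_expand_coe_polynomial (a : ℂ) (P : Polynomial ℂ) :
    VanishBelow 0 (expand (OnePoint.some a) (ι P)) := by
  rw [expand_coe_polynomial]
  exact vanishBelow_ofPowerSeries _

lemma expand_coe_polynomial_coeff_zero (a : ℂ) (P : Polynomial ℂ) :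
    (expand (OnePoint.some a) (ι P)).coeff 0 = P.eval a := by
  rw [expand_coe_polynomial]
  have := HahnSeries.ofPowerSeries_apply_coeff (Γ := ℤ)
    ((Polynomial.taylor a P : Polynomial ℂ) : PowerSeries ℂ) 0
  simpa using this

lemma invSubst_algebraMap (P : Polynomial ℂ) :
    invSubst (ι P) = Polynomial.aeval ((RatFunc.X : RatFunc ℂ)⁻¹) P := by
  unfold invSubst
  simp [RatFunc.liftAlgHom_apply]

lemma expand_infty_X : expand ∞ RatFunc.X = HahnSeries.single (-1) 1 := by
  have h : invSubst RatFunc.X = RatFunc.X⁻¹ := by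
    rw [← RatFunc.algebraMap_X, invSubst_algebraMap]
    simp
  have : expand ∞ RatFunc.X = algebraMap (RatFunc ℂ) (LaurentSeries ℂ) (invSubst RatFunc.X) := rfl
  rw [this, h, map_inv₀, RatFunc.coe_X]
  refine inv_eq_of_mul_eq_one_left ?_
  simp

lemma expand_infty_polynomial (P : Polynomial ℂ) :
    expand ∞ (ι P) = ∑ k ∈ P.support, HahnSeries.single (-(k : ℤ)) (P.coeff k) := by
  conv_lhs => rw [P.as_sum_support]
  rw [map_sum, map_sum]
  refine Finset.sum_congr rfl fun k _ => ?_
  rw [← Polynomial.C_mul_X_pow_eq_monomial, map_mul, map_pow, RatFunc.algebraMap_X,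
    RatFunc.algebraMap_C, map_mul, map_pow, expand_C, expand_infty_X, HahnSeries.single_pow]
  simp

lemma vanishBelow_expand_infty_polynomial {n : ℕ} (P : Polynomial ℂ) (hn : P.natDegree ≤ n) :
    VanishBelow (-(n : ℤ)) (expand ∞ (ι P)) := by
  rw [expand_infty_polynomial]
  refine VanishBelow.sum _ fun k hk => (VanishBelow.single _).mono ?_
  have := Polynomial.le_natDegree_of_mem_supp k hk
  lia

lemma expand_infty_polynomial_coeff_natDegree (P : Polynomial ℂ) :
    (expand ∞ (ι P)).coeff (-(P.natDegree : ℤ)) = P.leadingCoeff := by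
  rw [expand_infty_polynomial, HahnSeries.coeff_sum]
  by_cases hP : P = 0
  · simp [hP]
  rw [Finset.sum_eq_single P.natDegree]
  · simp
  · intro k _ hk
    exact HahnSeries.coeff_single_of_ne (by lia)
  · intro h
    simp [hP] at h

lemma expand_ne_zero {x : OnePoint ℂ} {f : RatFunc ℂ} (hf : f ≠ 0) : expand x f ≠ 0 := by
  simpa using hf

lemma algebraMap_ne_zero {P : Polynomial ℂ} (hP : P ≠ 0) : ι P ≠ 0 := by
  simpa using hP

lemma order_expand_infty_polynomial {P : Polynomial ℂ} (hP : P ≠ 0) :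
    (expand ∞ (ι P)).order = -(P.natDegree : ℤ) := by
  refine (vanishBelow_expand_infty_polynomial P le_rfl).eq_order ?_
  rw [expand_infty_polynomial_coeff_natDegree]
  simpa using hP

lemma order_expand_coe_polynomial {a : ℂ} {P : Polynomial ℂ} (hP : P.eval a ≠ 0) :
    (expand (OnePoint.some a) (ι P)).order = 0 := by
  refine (vanishBelow_expand_coe_polynomial a P).eq_order ?_
  rwa [expand_coe_polynomial_coeff_zero]

lemma expand_coe_X_sub_C (a : ℂ) :
    expand (OnePoint.some a) (RatFunc.X - RatFunc.C a) = HahnSeries.single 1 1 := by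
  have : RatFunc.X - RatFunc.C a = ι (Polynomial.X - Polynomial.C a) := by simp
  rw [this, expand_coe_polynomial]
  simp

lemma order_expand_div {x : OnePoint ℂ} {f g : RatFunc ℂ} (hf : f ≠ 0) (hg : g ≠ 0) :
    (expand x (f / g)).order = (expand x f).order - (expand x g).order := by
  have h : expand x (f / g) * expand x g = expand x f := by
    rw [← map_mul, div_mul_cancel₀ _ hg]
  rw [← h, HahnSeries.order_mul (expand_ne_zero (div_ne_zero hf hg)) (expand_ne_zero hg)]
  ring

/-! ### The elementary forms with logarithmic poles -/

/-- The form `dz / (z - a)` for a finite point `a`, and `0` for `∞`. -/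
def eta : OnePoint ℂ → RatFunc ℂ
  | ∞ => 0
  | OnePoint.some a => (RatFunc.X - RatFunc.C a)⁻¹

lemma X_sub_C_ne_zero (a : ℂ) : (RatFunc.X - RatFunc.C a : RatFunc ℂ) ≠ 0 := by
  have : RatFunc.X - RatFunc.C a = ι (Polynomial.X - Polynomial.C a) := by simp
  rw [this]
  exact algebraMap_ne_zero (Polynomial.X_sub_C_ne_zero a)

lemma expandForm_eta_self (a : ℂ) :
    expandForm (OnePoint.some a) (eta (OnePoint.some a)) = HahnSeries.single (-1) 1 := by
  have : expandForm (OnePoint.some a) (eta (OnePoint.some a)) =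
    expand (OnePoint.some a) ((RatFunc.X - RatFunc.C a)⁻¹) := rfl
  rw [this, map_inv₀, expand_coe_X_sub_C]
  refine inv_eq_of_mul_eq_one_left ?_
  simp

lemma vanishBelow_expandForm_eta_of_ne {a b : ℂ} (h : b ≠ a) :
    VanishBelow 0 (expandForm (OnePoint.some b) (eta (OnePoint.some a))) := by
  have e : expandForm (OnePoint.some b) (eta (OnePoint.some a)) =
    expand (OnePoint.some b) (1 / ι (Polynomial.X - Polynomial.C a)) := by
      simp [expandForm, eta]
  refine VanishBelow.of_order ?_
  rw [e, order_expand_div one_ne_zero (algebraMap_ne_zero (Polynomial.X_sub_C_ne_zero a)),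
    order_expand_coe_polynomial (by simpa [sub_eq_zero] using h)]
  simp

/-- In the coordinate 1/z the form is -z² / (z - a), and polynomial division leaves -z - a - a² / (z
- a). -/
lemma expandForm_infty_eta (a : ℂ) :
    ∃ A, VanishBelow 0 A ∧
      expandForm ∞ (eta (OnePoint.some a)) = HahnSeries.single (-1) (-1) + A := by
  refine ⟨-HahnSeries.C a - HahnSeries.C (a ^ 2) *
    expand ∞ (1 / ι (Polynomial.X - Polynomial.C a)), ?_, ?_⟩
  · have h0 : ∀ c : ℂ, VanishBelow 0 (HahnSeries.C c : LaurentSeries ℂ) :=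
      fun c => VanishBelow.single c
    refine (h0 a).neg.sub ?_
    have := (h0 (a ^ 2)).mul (n := 0) (B := expand ∞ (1 / ι (Polynomial.X - Polynomial.C a)))
      (VanishBelow.of_order ?_)
    · simpa using this
    · rw [order_expand_div one_ne_zero (algebraMap_ne_zero (Polynomial.X_sub_C_ne_zero a)),
        order_expand_infty_polynomial (Polynomial.X_sub_C_ne_zero a)]
      simp
  · have e : (-RatFunc.X ^ 2 * eta (OnePoint.some a) : RatFunc ℂ) =
        -RatFunc.X + (-RatFunc.C a - RatFunc.C (a ^ 2) *
          (1 / ι (Polynomial.X - Polynomial.C a))) := by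
      have := X_sub_C_ne_zero a
      simp only [eta, map_sub, RatFunc.algebraMap_X, RatFunc.algebraMap_C, map_pow]
      field_simp
      ring
    have : expandForm ∞ (eta (OnePoint.some a)) =
      expand ∞ (-RatFunc.X ^ 2 * eta (OnePoint.some a)) := rfl
    rw [this, e]
    simp only [map_add, map_sub, map_neg, map_mul, expand_C, expand_infty_X]
    simp

lemma expandForm_eta_infty (x : OnePoint ℂ) : expandForm x (eta ∞) = 0 := expandForm_zero x

lemma vanishBelow_expandForm_eta (x y : OnePoint ℂ) : VanishBelow (-1) (expandForm x (eta y)) := by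
  induction y using OnePoint.rec with
  | infty => rw [expandForm_eta_infty]; exact VanishBelow.zero
  | coe a =>
    induction x using OnePoint.rec with
    | infty =>
      obtain ⟨A, hA, h⟩ := expandForm_infty_eta a
      rw [h]
      exact (VanishBelow.single _).add (hA.mono (by norm_num))
    | coe b =>
      by_cases hab : b = a
      · subst hab
        rw [expandForm_eta_self]
        exact VanishBelow.single _
      · exact (vanishBelow_expandForm_eta_of_ne hab).mono (by norm_num)

open Classical in
-- With the convention `eta ∞ = 0` one formula covers every `y`. In a combination whose coefficients
-- sum to zero the last term drops out, so it need not be known whether `∞` is marked.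
lemma residue_eta (x y : OnePoint ℂ) :
    residue x (eta y) = (if x = y then 1 else 0) - (if x = ∞ then 1 else 0) := by
  induction y using OnePoint.rec with
  | infty => simp [residue, expandForm_eta_infty]
  | coe a =>
    induction x using OnePoint.rec with
    | infty =>
      obtain ⟨A, hA, h⟩ := expandForm_infty_eta a
      simp [residue, h, hA (-1) (by norm_num)]
    | coe b =>
      by_cases hab : b = a
      · subst hab
        simp [residue, expandForm_eta_self]
      · simp [residue, vanishBelow_expandForm_eta_of_ne hab (-1) (by norm_num), hab]

/-- The expansion of one-forms at a point, as a linear map. -/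
def expandFormₗ (x : OnePoint ℂ) : RatFunc ℂ →ₗ[ℂ] LaurentSeries ℂ where
  toFun := expandForm x
  map_add' := expandForm_add x
  map_smul' := expandForm_smul x

lemma expandForm_sum {κ : Type*} (x : OnePoint ℂ) (s : Finset κ) (f : κ → RatFunc ℂ) :
    expandForm x (∑ i ∈ s, f i) = ∑ i ∈ s, expandForm x (f i) :=
  map_sum (expandFormₗ x) f s

/-- The residue at a point, as a linear map. -/
def residueₗ (x : OnePoint ℂ) : RatFunc ℂ →ₗ[ℂ] ℂ where
  toFun := residue x
  map_add' f g := by simp [residue, expandForm_add]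
  map_smul' c f := by simp [residue, expandForm_smul]

lemma residue_zero (x : OnePoint ℂ) : residue x 0 = 0 := map_zero (residueₗ x)

lemma residue_add (x : OnePoint ℂ) (f g : RatFunc ℂ) :
    residue x (f + g) = residue x f + residue x g := map_add (residueₗ x) f g

lemma residue_smul (x : OnePoint ℂ) (c : ℂ) (f : RatFunc ℂ) :
    residue x (c • f) = c * residue x f := map_smul (residueₗ x) c f

lemma residue_sum {κ : Type*} (x : OnePoint ℂ) (s : Finset κ) (f : κ → RatFunc ℂ) :
    residue x (∑ i ∈ s, f i) = ∑ i ∈ s, residue x (f i) :=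
  map_sum (residueₗ x) f s

lemma expandForm_sub (x : OnePoint ℂ) (f g : RatFunc ℂ) :
    expandForm x (f - g) = expandForm x f - expandForm x g := map_sub (expandFormₗ x) f g

/-! ### Forms with prescribed residues -/

/-- At a root of the denominator, regularity would make the numerator vanish as well, against
coprimality. -/
lemma exists_polynomial_of_regular {f : RatFunc ℂ}
    (h : ∀ a : ℂ, VanishBelow 0 (expand (OnePoint.some a) f)) : ∃ P : Polynomial ℂ, f = ι P := by
  have hdeg : f.denom.degree = 0 := by
    by_contra hne
    obtain ⟨a, ha⟩ := IsAlgClosed.exists_root f.denom hne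
    have e : expand (OnePoint.some a) f * expand (OnePoint.some a) (ι f.denom) =
        expand (OnePoint.some a) (ι f.num) := by
      rw [← map_mul]
      exact congrArg _ ((div_eq_iff (algebraMap_ne_zero (RatFunc.denom_ne_zero f))).mp
        (RatFunc.num_div_denom f)).symm
    have h1 := (h a).coeff_mul (vanishBelow_expand_coe_polynomial a f.denom)
    rw [e, zero_add, expand_coe_polynomial_coeff_zero, expand_coe_polynomial_coeff_zero,
      Polynomial.IsRoot.def.mp ha, mul_zero] at h1
    obtain ⟨u, w, huw⟩ := f.isCoprime_num_denom
    have := congrArg (Polynomial.eval a) huw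
    simp [h1, Polynomial.IsRoot.def.mp ha] at this
  have h1 : f.denom = 1 := by
    rw [Polynomial.eq_C_of_degree_eq_zero hdeg]
    have := RatFunc.monic_denom f
    rw [Polynomial.eq_C_of_degree_eq_zero hdeg, Polynomial.Monic, Polynomial.leadingCoeff_C] at this
    rw [this, map_one]
  refine ⟨f.num, ?_⟩
  conv_lhs => rw [← RatFunc.num_div_denom f, h1]
  simp

/-- A nonzero polynomial form P dz has a pole of order deg P + 2 at infinity, hence of order at
least 2. -/
lemma eq_zero_of_regular {f : RatFunc ℂ}
    (h : ∀ a : ℂ, VanishBelow 0 (expandForm (OnePoint.some a) f))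
    (hinf : VanishBelow (-1) (expandForm ∞ f)) : f = 0 := by
  obtain ⟨P, rfl⟩ := exists_polynomial_of_regular h
  by_contra hne
  have hP : P ≠ 0 := by rintro rfl; simp at hne
  have e : expandForm ∞ (ι P) = expand ∞ (ι (-Polynomial.X ^ 2 * P)) := by
    simp [expandForm]
  have hQ : -Polynomial.X ^ 2 * P ≠ 0 := by simp [hP]
  have h2 := expand_infty_polynomial_coeff_natDegree (-Polynomial.X ^ 2 * P)
  have hd : (-Polynomial.X ^ 2 * P : Polynomial ℂ).natDegree = P.natDegree + 2 := by
    rw [Polynomial.natDegree_mul (by simp) hP]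
    simp [add_comm]
  rw [← e, hinf _ (by rw [hd]; push_cast; lia)] at h2
  exact hQ (Polynomial.leadingCoeff_eq_zero.mp h2.symm)

section LogForms

variable {κ : Type*} {pt : κ → OnePoint ℂ}

/-- A form with at most logarithmic poles at the points `pt` and no other poles. -/
def IsLogForm (pt : κ → OnePoint ℂ) (f : RatFunc ℂ) : Prop :=
  (∀ x, (∀ k, pt k ≠ x) → VanishBelow 0 (expandForm x f)) ∧
    ∀ k, VanishBelow (-1) (expandForm (pt k) f)

lemma IsLogForm.vanishBelow {f : RatFunc ℂ} (h : IsLogForm pt f) (x : OnePoint ℂ) :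
    VanishBelow (-1) (expandForm x f) := by
  by_cases hx : ∀ k, pt k ≠ x
  · exact (h.1 x hx).mono (by norm_num)
  · push Not at hx
    obtain ⟨k, rfl⟩ := hx
    exact h.2 k

lemma residue_sum_eta [Fintype κ] (hpt : Function.Injective pt) (ρ : κ → ℂ) (hρ : ∑ k, ρ k = 0) (k : κ) :
    residue (pt k) (∑ l, ρ l • eta (pt l)) = ρ k := by
  classical
  simp only [residue_sum, residue_smul, residue_eta, mul_sub, Finset.sum_sub_distrib,
    ← Finset.sum_mul, hρ, zero_mul, sub_zero]
  simp [hpt.eq_iff]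

lemma isLogForm_sum_eta [Fintype κ] (ρ : κ → ℂ) (hρ : ∑ k, ρ k = 0) :
    IsLogForm pt (∑ l, ρ l • eta (pt l)) := by
  classical
  have h1 : ∀ x, VanishBelow (-1) (expandForm x (∑ l, ρ l • eta (pt l))) := by
    intro x
    rw [expandForm_sum]
    refine VanishBelow.sum _ fun l _ => ?_
    rw [expandForm_smul]
    exact (vanishBelow_expandForm_eta _ _).smul _
  refine ⟨fun x hx k hk => ?_, fun k => h1 _⟩
  rcases (Int.le_sub_one_of_lt hk).lt_or_eq with hk | rfl
  · exact h1 x k (by simpa using hk)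
  · change residue x _ = 0
    simp only [residue_sum, residue_smul, residue_eta, mul_sub, Finset.sum_sub_distrib,
      ← Finset.sum_mul, hρ, zero_mul, sub_zero]
    simp [fun k => (hx k).symm]

/-- The difference of the two sides has no finite pole and at most a simple one at infinity, so
`eq_zero_of_regular` applies. The residue at infinity need not be matched beforehand. -/
lemma IsLogForm.eq_sum_eta [Fintype κ] (hpt : Function.Injective pt) {f : RatFunc ℂ} (h : IsLogForm pt f) :
    f = ∑ l, residue (pt l) f • eta (pt l) := by
  classical
  rw [← sub_eq_zero]
  have hlog : ∀ x, VanishBelow (-1) (expandForm x (∑ l, residue (pt l) f • eta (pt l))) := by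
    intro x
    rw [expandForm_sum]
    refine VanishBelow.sum _ fun l _ => ?_
    rw [expandForm_smul]
    exact (vanishBelow_expandForm_eta _ _).smul _
  refine eq_zero_of_regular (fun a k hk => ?_) ?_
  · rcases (Int.le_sub_one_of_lt hk).lt_or_eq with hk | rfl
    · rw [expandForm_sub]
      exact ((h.vanishBelow _).sub (hlog _)) k (by simpa using hk)
    · rw [expandForm_sub, HahnSeries.coeff_sub, sub_eq_zero]
      change residue (OnePoint.some a) f = residue (OnePoint.some a) _
      simp only [residue_sum, residue_smul, residue_eta]
      by_cases hx : ∀ k, pt k ≠ OnePoint.some a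
      · have h0 : residue (OnePoint.some a) f = 0 := h.1 _ hx (-1) (by norm_num)
        simp [fun k => (hx k).symm, h0]
      · push Not at hx
        obtain ⟨k, hk⟩ := hx
        simp [← hk, hpt.eq_iff]
        simp [hk]
  · rw [expandForm_sub]
    exact (h.vanishBelow _).sub (hlog _)

/-- The residue theorem comes out of comparing residues at `∞` in `IsLogForm.eq_sum_eta`. -/
lemma IsLogForm.sum_residue [Fintype κ] (hpt : Function.Injective pt) {f : RatFunc ℂ} (h : IsLogForm pt f) :
    ∑ l, residue (pt l) f = 0 := by
  classical
  have e := congrArg (residue ∞) (h.eq_sum_eta hpt)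
  simp only [residue_sum, residue_smul, residue_eta, if_true, mul_sub, mul_one,
    Finset.sum_sub_distrib] at e
  by_cases hx : ∀ k, pt k ≠ ∞
  · have h0 : residue ∞ f = 0 := h.1 _ hx (-1) (by norm_num)
    simpa [fun k => (hx k).symm, h0] using e
  · push Not at hx
    obtain ⟨k, hk⟩ := hx
    rw [← hk] at e
    simp only [hpt.eq_iff, mul_ite, mul_one, mul_zero, Finset.sum_ite_eq, Finset.mem_univ,
      if_true] at e
    linear_combination e

end LogForms

/-- The product of the expansions of two forms at a point depends only on the product of the
forms, and vanishes if the latter does. -/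
lemma sum_expandForm_mul_eq_zero {κ : Type*} [Fintype κ] (x : OnePoint ℂ) (f g : κ → RatFunc ℂ)
    (h : ∑ i, f i * g i = 0) : ∑ i, expandForm x (f i) * expandForm x (g i) = 0 := by
  induction x using OnePoint.rec with
  | infty =>
    simp only [expandForm, ← map_mul, ← map_sum]
    have : ∑ i, -RatFunc.X ^ 2 * f i * (-RatFunc.X ^ 2 * g i) =
        RatFunc.X ^ 4 * ∑ i, f i * g i := by
      rw [Finset.mul_sum]
      exact Finset.sum_congr rfl fun i _ => by ring
    rw [this, h, mul_zero, map_zero]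
  | coe a =>
    simp only [expandForm, ← map_mul, ← map_sum, h, map_zero]

/-- A product of two simple poles has the product of the residues as its coefficient at exponent -2.
This turns the equation between forms into a pairing of residues with directions. -/
lemma sum_residue_mul_eq_zero {κ : Type*} [Fintype κ] (x : OnePoint ℂ) (f g : κ → RatFunc ℂ)
    (hf : ∀ i, VanishBelow (-1) (expandForm x (f i)))
    (hg : ∀ i, VanishBelow (-1) (expandForm x (g i)))
    (h : ∑ i, f i * g i = 0) : ∑ i, residue x (f i) * residue x (g i) = 0 := by
  have e := congrArg (fun A => HahnSeries.coeff A (-1 + -1)) (sum_expandForm_mul_eq_zero x f g h)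
  simp only [HahnSeries.coeff_sum, HahnSeries.coeff_zero] at e
  rw [← e]
  exact Finset.sum_congr rfl fun i _ => ((hf i).coeff_mul (hg i)).symm

/-! ### Logarithmic derivatives -/

lemma logDeriv_polynomial_coe {P : Polynomial ℂ} (hP : P ≠ 0) (a : ℂ) :
    VanishBelow 0 (expand (OnePoint.some a) (ι (Polynomial.derivative P) / ι P) -
      HahnSeries.single (-1) ((expand (OnePoint.some a) (ι P)).order : ℂ)) := by
  obtain ⟨Q, hPQ, hQ⟩ := Polynomial.exists_eq_pow_rootMultiplicity_mul_and_not_dvd P hP a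
  -- From P = (z - a)^m Q one gets P'/P = m / (z - a) + Q'/Q, and Q'/Q is regular at a.
  set m := P.rootMultiplicity a
  have hQ0 : Q ≠ 0 := by rintro rfl; simp at hQ
  have hQa : Q.eval a ≠ 0 := by
    rwa [Polynomial.dvd_iff_isRoot, Polynomial.IsRoot.def] at hQ
  have hX := X_sub_C_ne_zero a
  have hιQ := algebraMap_ne_zero hQ0
  have e1 : ι P = (RatFunc.X - RatFunc.C a) ^ m * ι Q := by
    rw [hPQ]; simp
  have e2 : ι (Polynomial.derivative P) / ι P =
      (m : ℂ) • eta (OnePoint.some a) + ι (Polynomial.derivative Q) / ι Q := by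
    rw [e1, hPQ, RatFunc.smul_eq_C_mul]
    simp only [Polynomial.derivative_mul, Polynomial.derivative_X_sub_C_pow, map_add, map_mul,
      map_pow, map_sub, RatFunc.algebraMap_X, RatFunc.algebraMap_C, eta, map_natCast]
    rcases Nat.eq_zero_or_pos m with h0 | hpos
    · simp [h0]
    · obtain ⟨l, hl⟩ := Nat.exists_eq_succ_of_ne_zero hpos.ne'
      rw [hl]
      simp only [Nat.succ_eq_add_one, Nat.add_sub_cancel]
      field_simp
      ring
  have e3 : (expand (OnePoint.some a) (ι P)).order = m := by
    rw [e1, map_mul, map_pow, expand_coe_X_sub_C, HahnSeries.single_pow,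
      HahnSeries.order_mul (by simp) (expand_ne_zero hιQ), order_expand_coe_polynomial hQa]
    simp [HahnSeries.order_single]
  rw [e2, e3, map_add, RatFunc.smul_eq_C_mul, map_mul, expand_C]
  have e4 : expand (OnePoint.some a) (eta (OnePoint.some a)) = HahnSeries.single (-1) 1 :=
    expandForm_eta_self a
  rw [e4]
  have e5 : (HahnSeries.C (m : ℂ) : LaurentSeries ℂ) * HahnSeries.single (-1) 1 =
    HahnSeries.single (-1) (((m : ℤ) : ℂ)) := by
    rw [HahnSeries.C_apply, HahnSeries.single_mul_single]
    simp
  rw [e5, add_sub_cancel_left]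
  by_cases hQ' : Polynomial.derivative Q = 0
  · simp [hQ', VanishBelow.zero]
  refine VanishBelow.of_order ?_
  rw [order_expand_div (algebraMap_ne_zero hQ') hιQ, order_expand_coe_polynomial hQa, sub_zero]
  by_contra! hlt
  have := vanishBelow_expand_coe_polynomial a (Polynomial.derivative Q) _ hlt
  exact HahnSeries.coeff_order_eq_zero.not.mpr (expand_ne_zero (algebraMap_ne_zero hQ')) this

lemma logDeriv_polynomial_infty {P : Polynomial ℂ} (hP : P ≠ 0) :
    VanishBelow 0 (expandForm ∞ (ι (Polynomial.derivative P) / ι P) -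
      HahnSeries.single (-1) ((expand ∞ (ι P)).order : ℂ)) := by
  -- The leading terms of X P' and (deg P) P cancel, so Q has smaller degree than P and the
  -- remainder X Q / P is regular at infinity.
  set Q := Polynomial.X * Polynomial.derivative P - (P.natDegree : Polynomial ℂ) * P with hQ
  have hιP := algebraMap_ne_zero hP
  have e1 : (-RatFunc.X ^ 2 * (ι (Polynomial.derivative P) / ι P) : RatFunc ℂ) =
      -((P.natDegree : RatFunc ℂ) * RatFunc.X) - ι (Polynomial.X * Q) / ι P := by
    rw [hQ]
    simp only [map_mul, map_sub, map_natCast, RatFunc.algebraMap_X]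
    field_simp
    ring
  have e0 : expandForm ∞ (ι (Polynomial.derivative P) / ι P) =
      expand ∞ (-RatFunc.X ^ 2 * (ι (Polynomial.derivative P) / ι P)) := rfl
  rw [e0, e1, order_expand_infty_polynomial hP, map_sub, map_neg, map_mul, map_natCast,
    expand_infty_X]
  have e5 : ((P.natDegree : LaurentSeries ℂ)) * HahnSeries.single (-1) 1 =
      -HahnSeries.single (-1) (((-(P.natDegree : ℤ) : ℤ)) : ℂ) := by
    rw [← map_natCast (HahnSeries.C : ℂ →+* LaurentSeries ℂ), HahnSeries.C_apply,
      HahnSeries.single_mul_single, ← HahnSeries.single_neg]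
    simp
  rw [e5, neg_neg, sub_right_comm, sub_self, zero_sub]
  refine VanishBelow.neg ?_
  by_cases hQ0 : Q = 0
  · simp [hQ0, VanishBelow.zero]
  have hXQ : Polynomial.X * Q ≠ 0 := mul_ne_zero Polynomial.X_ne_zero hQ0
  refine VanishBelow.of_order ?_
  rw [order_expand_div (algebraMap_ne_zero hXQ) hιP, order_expand_infty_polynomial hP,
    order_expand_infty_polynomial hXQ, Polynomial.natDegree_X_mul hQ0]
  have hlt : Q.natDegree < P.natDegree := by
    have hc : ∀ k, Q.coeff k = ((k : ℂ) - P.natDegree) * P.coeff k := by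
      intro k
      rw [hQ, ← Polynomial.C_eq_natCast, Polynomial.coeff_sub, Polynomial.coeff_C_mul]
      cases k with
      | zero => simp
      | succ k =>
        rw [Polynomial.coeff_X_mul, Polynomial.coeff_derivative]
        push_cast
        ring
    have hne : Q.coeff Q.natDegree ≠ 0 := by simpa using hQ0
    rw [hc] at hne
    refine lt_of_le_of_ne (Polynomial.le_natDegree_of_ne_zero (right_ne_zero_of_mul hne)) ?_
    intro h
    exact left_ne_zero_of_mul hne (by rw [h, sub_self])
  lia

lemma expandForm_dlog {g : RatFunc ℂ} (hg : g ≠ 0) (x : OnePoint ℂ) :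
    VanishBelow 0 (expandForm x (dlog g) -
      HahnSeries.single (-1) ((expand x g).order : ℂ)) := by
  have hn : g.num ≠ 0 := RatFunc.num_ne_zero hg
  have hd : g.denom ≠ 0 := RatFunc.denom_ne_zero g
  have key : ∀ P : Polynomial ℂ, P ≠ 0 →
      VanishBelow 0 (expandForm x (ι (Polynomial.derivative P) / ι P) -
        HahnSeries.single (-1) ((expand x (ι P)).order : ℂ)) := by
    intro P hP
    induction x using OnePoint.rec with
    | infty => exact logDeriv_polynomial_infty hP
    | coe a => exact logDeriv_polynomial_coe hP a
  have ho : (expand x g).order =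
      (expand x (ι g.num)).order - (expand x (ι g.denom)).order := by
    conv_lhs => rw [← RatFunc.num_div_denom g]
    exact order_expand_div (algebraMap_ne_zero hn) (algebraMap_ne_zero hd)
  have := (key _ hn).sub (key _ hd)
  have hs : ∀ a b : ℂ, (HahnSeries.single (-1) (a - b) : LaurentSeries ℂ) =
      HahnSeries.single (-1) a - HahnSeries.single (-1) b := HahnSeries.single_sub _
  rw [ho, dlog, expandForm_sub, Int.cast_sub, hs]
  convert this using 1
  ring

lemma vanishBelow_expandForm_dlog {g : RatFunc ℂ} (hg : g ≠ 0) (x : OnePoint ℂ) :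
    VanishBelow (-1) (expandForm x (dlog g)) := by
  have := ((expandForm_dlog hg x).mono (by norm_num : (-1 : ℤ) ≤ 0)).add
    (VanishBelow.single (n := -1) ((expand x g).order : ℂ))
  simpa using this

lemma residue_dlog {g : RatFunc ℂ} (hg : g ≠ 0) (x : OnePoint ℂ) :
    residue x (dlog g) = ((expand x g).order : ℂ) := by
  have := expandForm_dlog hg x (-1) (by norm_num)
  rw [HahnSeries.coeff_sub, HahnSeries.coeff_single_same, sub_eq_zero] at this
  exact this

lemma isLogForm_dlog {κ : Type*} {pt : κ → OnePoint ℂ} {g : RatFunc ℂ} (hg : g ≠ 0)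
    (h : ∀ x, (∀ k, pt k ≠ x) → (expand x g).order = 0) : IsLogForm pt (dlog g) := by
  refine ⟨fun x hx => ?_, fun k => vanishBelow_expandForm_dlog hg _⟩
  have := expandForm_dlog hg x
  rw [h x hx] at this
  simpa using this

end TropLine

end

noncomputable section

namespace TropLine

/-! ### Values of convergent Laurent series -/

/-- The Laurent series `q` converges for `0 < ‖t‖ < ε`. -/
def ConvergesBelow (ε : ℝ) (q : LaurentSeries ℂ) : Prop :=
  ∀ t : ℂ, 0 < ‖t‖ → ‖t‖ < ε → Summable fun k : ℤ => q.coeff k * t ^ k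

lemma ConvergesBelow.sub {ε : ℝ} {q q' : LaurentSeries ℂ} (h : ConvergesBelow ε q)
    (h' : ConvergesBelow ε q') : ConvergesBelow ε (q - q') := fun t h0 h1 => by
  simpa [sub_mul] using (h t h0 h1).sub (h' t h0 h1)

lemma ConvergesBelow.value_sub {ε : ℝ} {q q' : LaurentSeries ℂ} (h : ConvergesBelow ε q)
    (h' : ConvergesBelow ε q') {t : ℂ} (h0 : 0 < ‖t‖) (h1 : ‖t‖ < ε) :
    value (q - q') t = value q t - value q' t := by
  simp only [value, HahnSeries.coeff_sub, sub_mul]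
  exact (h t h0 h1).tsum_sub (h' t h0 h1)

/-- A Laurent series which vanishes below the exponent `d` has values of order `t ^ d`. -/
lemma ConvergesBelow.norm_value_le {ε δ : ℝ} (hδ : 0 < δ) (hδε : δ < ε) {q : LaurentSeries ℂ}
    (h : ConvergesBelow ε q) {d : ℤ} (hd : VanishBelow d q) :
    ∃ C, 0 ≤ C ∧ ∀ t : ℂ, 0 < ‖t‖ → ‖t‖ < δ → ‖value q t‖ ≤ C * ‖t‖ ^ d := by
  have hδn : ‖(δ : ℂ)‖ = δ := by simp [abs_of_pos hδ]
  have hs : Summable fun k : ℤ => ‖q.coeff k * (δ : ℂ) ^ k‖ :=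
    (h δ (by rwa [hδn]) (by rwa [hδn])).norm
  -- The constant is the absolute sum of the series at the point δ, divided by δ ^ d; each term at t
  -- is compared with the term at δ.
  refine ⟨(∑' k : ℤ, ‖q.coeff k * (δ : ℂ) ^ k‖) * (δ ^ d)⁻¹, by positivity, fun t h0 h1 => ?_⟩
  have hle : ∀ k : ℤ, ‖q.coeff k * t ^ k‖ ≤ ‖q.coeff k * (δ : ℂ) ^ k‖ * ((δ ^ d)⁻¹ * ‖t‖ ^ d) := by
    intro k
    rcases lt_or_ge k d with hk | hk
    · simp [hd k hk]
    · obtain ⟨n, rfl⟩ := Int.le.dest hk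
      rw [norm_mul, norm_mul, norm_zpow, norm_zpow, hδn, mul_assoc]
      refine mul_le_mul_of_nonneg_left ?_ (norm_nonneg _)
      rw [zpow_add₀ h0.ne', zpow_add₀ hδ.ne', zpow_natCast, zpow_natCast]
      have h2 : ‖t‖ ^ n ≤ δ ^ n := pow_le_pow_left₀ h0.le h1.le n
      calc ‖t‖ ^ d * ‖t‖ ^ n ≤ ‖t‖ ^ d * δ ^ n := by gcongr
        _ = δ ^ d * δ ^ n * ((δ ^ d)⁻¹ * ‖t‖ ^ d) := by
          field_simp
  have hs' := hs.mul_right ((δ ^ d)⁻¹ * ‖t‖ ^ d)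
  calc ‖value q t‖ ≤ ∑' k : ℤ, ‖q.coeff k * (δ : ℂ) ^ k‖ * ((δ ^ d)⁻¹ * ‖t‖ ^ d) :=
        tsum_of_norm_bounded hs'.hasSum hle
    _ = _ := by rw [tsum_mul_right]; ring

/-- The values of a Laurent series of order `d` are bounded below by a multiple of `t ^ d`. -/
lemma ConvergesBelow.le_norm_value {ε : ℝ} (hε : 0 < ε) {q : LaurentSeries ℂ}
    (h : ConvergesBelow ε q) (hq : q ≠ 0) :
    ∃ δ, 0 < δ ∧ ∃ c, 0 < c ∧ ∀ t : ℂ, 0 < ‖t‖ → ‖t‖ < δ → c * ‖t‖ ^ q.order ≤ ‖value q t‖ := by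
  set d := q.order
  set a := q.coeff d with ha
  have ha0 : a ≠ 0 := HahnSeries.coeff_order_eq_zero.not.mpr hq
  have hm : ConvergesBelow ε (HahnSeries.single d a) := by
    intro t _ _
    refine summable_of_ne_finset_zero (s := {d}) fun k hk => ?_
    rw [HahnSeries.coeff_single_of_ne (by simpa using hk), zero_mul]
  have hv : VanishBelow (d + 1) (q - HahnSeries.single d a) :=
    (VanishBelow.of_order le_rfl).sub_single
  obtain ⟨C, hC, hb⟩ := (h.sub hm).norm_value_le (half_pos hε) (half_lt_self hε) hv
  have hna : 0 < ‖a‖ := norm_pos_iff.mpr ha0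
  -- Below this radius the remainder, of size C‖t‖^(d+1), is at most half of the leading term; the
  -- `+ 1` keeps the denominator positive when C = 0.
  refine ⟨min (ε / 2) (‖a‖ / (2 * (C + 1))), by positivity, ‖a‖ / 2, by positivity,
    fun t h0 h1 => ?_⟩
  have h2 : ‖t‖ < ε / 2 := h1.trans_le (min_le_left _ _)
  have h3 : ‖t‖ < ‖a‖ / (2 * (C + 1)) := h1.trans_le (min_le_right _ _)
  have h4 := hb t h0 h2
  rw [h.value_sub hm h0 (by linarith)] at h4
  have h5 : value (HahnSeries.single d a) t = a * t ^ d := by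
    rw [value, tsum_eq_single d]
    · simp
    · intro k hk
      rw [HahnSeries.coeff_single_of_ne hk, zero_mul]
  rw [h5, zpow_add₀ h0.ne', zpow_one] at h4
  have h6 : ‖a * t ^ d‖ = ‖a‖ * ‖t‖ ^ d := by rw [norm_mul, norm_zpow]
  have h7 := norm_sub_norm_le (a * t ^ d) (a * t ^ d - value q t)
  rw [sub_sub_cancel, h6, norm_sub_rev] at h7
  have h8 : 0 < ‖t‖ ^ d := by positivity
  rw [lt_div_iff₀ (by positivity)] at h3
  nlinarith [mul_pos h8 h0]

/-- The quotient of the values of two Laurent series is of order `t` if the orders are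
different. -/
lemma exists_norm_value_div_le {ε : ℝ} (hε : 0 < ε) {q q' : LaurentSeries ℂ}
    (h : ConvergesBelow ε q) (h' : ConvergesBelow ε q') (hq' : q' ≠ 0)
    (hv : VanishBelow (q'.order + 1) q) :
    ∃ δ, 0 < δ ∧ ∃ K, ∀ t : ℂ, 0 < ‖t‖ → ‖t‖ < δ → ‖value q t / value q' t‖ ≤ K * ‖t‖ := by
  obtain ⟨C, hC, hb⟩ := h.norm_value_le (half_pos hε) (half_lt_self hε) hv
  obtain ⟨δ, hδ, c, hc, hb'⟩ := h'.le_norm_value hε hq'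
  refine ⟨min (ε / 2) δ, by positivity, C / c, fun t h0 h1 => ?_⟩
  have h2 := hb t h0 (h1.trans_le (min_le_left _ _))
  have h3 := hb' t h0 (h1.trans_le (min_le_right _ _))
  have h4 : 0 < c * ‖t‖ ^ q'.order := by positivity
  rw [norm_div, div_le_iff₀ (h4.trans_le h3)]
  rw [zpow_add₀ h0.ne', zpow_one] at h2
  calc ‖value q t‖ ≤ C * (‖t‖ ^ q'.order * ‖t‖) := h2
    _ = C / c * ‖t‖ * (c * ‖t‖ ^ q'.order) := by field_simp
    _ ≤ _ := by gcongr

/-! ### Perturbation of kernels -/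

/-- If `A t` is a perturbation of order `t` of a split surjective linear map `A₀`, then the kernels
of `A₀` and `A t` are isomorphic for small `t`, by isomorphisms close to the identity. -/
lemma exists_ker_equiv {E κ : Type*} [AddCommGroup E] [Module ℂ E] [Fintype κ]
    (A₀ : E →ₗ[ℂ] κ → ℂ) (A : ℂ → E →ₗ[ℂ] κ → ℂ) (B : (κ → ℂ) →ₗ[ℂ] E)
    (hB : ∀ y, A₀ (B y) = y) {δ : ℝ} (hδ : 0 < δ)
    (hA : ∀ x, ∃ K, ∀ t : ℂ, 0 < ‖t‖ → ‖t‖ < δ → ‖A t x - A₀ x‖ ≤ K * ‖t‖) :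
    ∃ ε, 0 < ε ∧ ε ≤ δ ∧ ∃ Φ : ∀ t : {t : ℂ // 0 < ‖t‖ ∧ ‖t‖ < ε},
      LinearMap.ker A₀ ≃ₗ[ℂ] LinearMap.ker (A t),
      ∀ (x : LinearMap.ker A₀) (l : E →ₗ[ℂ] ℂ), ∃ K, ∀ t,
        ‖l (Φ t x) - l x‖ ≤ K * ‖(t : ℂ)‖ := by
  classical
  choose K hK using hA
  -- In the sup norm N‖t‖ bounds the operator `A t ∘ B - id`, since y is the sum of its entries
  -- times the basis vectors.
  set N : ℝ := ∑ k, |K (B (Pi.single k 1))| with hN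
  have hN0 : 0 ≤ N := Finset.sum_nonneg fun _ _ => abs_nonneg _
  have hdiff : ∀ (t : ℂ), 0 < ‖t‖ → ‖t‖ < δ → ∀ y, ‖A t (B y) - y‖ ≤ N * ‖t‖ * ‖y‖ := by
    intro t h0 h1 y
    have e : A t (B y) - y = ∑ k, y k • (A t (B (Pi.single k 1)) - A₀ (B (Pi.single k 1))) := by
      have hy : y = ∑ k, y k • (Pi.single k 1 : κ → ℂ) := by
        ext i
        simp [Finset.sum_apply, Pi.single_apply]
      conv_lhs => rw [hy]
      simp only [map_sum, map_smul, hB, smul_sub, Finset.sum_sub_distrib]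
    rw [e, hN, Finset.sum_mul, Finset.sum_mul]
    refine (norm_sum_le _ _).trans (Finset.sum_le_sum fun k _ => ?_)
    rw [norm_smul, mul_comm]
    refine mul_le_mul ((hK _ t h0 h1).trans ?_) (norm_le_pi_norm y k) (norm_nonneg _) (by positivity)
    gcongr
    exact le_abs_self _
  -- Once N‖t‖ ≤ 1/2, the map `A t ∘ B` is bounded below by 1/2. Being an injective endomorphism of
  -- a finite-dimensional space, it is invertible.
  have hlow : ∀ t : ℂ, 0 < ‖t‖ → ‖t‖ < min δ (1 / (2 * (N + 1))) → ∀ y,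
      ‖y‖ ≤ 2 * ‖A t (B y)‖ := by
    intro t h0 h1 y
    have h2 := hdiff t h0 (h1.trans_le (min_le_left _ _)) y
    have h3 := h1.trans_le (min_le_right _ _)
    rw [lt_div_iff₀ (by positivity)] at h3
    have h4 := norm_sub_norm_le y (y - A t (B y))
    rw [sub_sub_cancel, norm_sub_rev] at h4
    have h5 : N * ‖t‖ * ‖y‖ ≤ 1 / 2 * ‖y‖ := by
      refine mul_le_mul_of_nonneg_right ?_ (norm_nonneg _)
      nlinarith
    linarith
  refine ⟨min δ (1 / (2 * (N + 1))), by positivity, min_le_left _ _, ?_⟩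
  have hinj : ∀ t : {t : ℂ // 0 < ‖t‖ ∧ ‖t‖ < min δ (1 / (2 * (N + 1)))},
      Function.Injective ((A t).comp B) := by
    intro t
    rw [injective_iff_map_eq_zero]
    intro y hy
    have := hlow t t.2.1 t.2.2 y
    rw [← LinearMap.comp_apply, hy, norm_zero, mul_zero] at this
    exact norm_le_zero_iff.mp this
  let M : ∀ t : {t : ℂ // 0 < ‖t‖ ∧ ‖t‖ < min δ (1 / (2 * (N + 1)))}, (κ → ℂ) ≃ₗ[ℂ] (κ → ℂ) :=
    fun t => LinearEquiv.ofInjectiveEndo ((A t).comp B) (hinj t)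
  have hM : ∀ (t : {t : ℂ // 0 < ‖t‖ ∧ ‖t‖ < min δ (1 / (2 * (N + 1)))}) (y : κ → ℂ),
      A t (B ((M t).symm y)) = y := fun t y => (M t).apply_symm_apply y
  -- `P t` projects onto the kernel of `A t` along the image of `B`, and `P₀` projects onto the
  -- kernel of `A₀` along the same image. Restricted to the two kernels they are therefore mutually
  -- inverse.
  let P : ∀ t : {t : ℂ // 0 < ‖t‖ ∧ ‖t‖ < min δ (1 / (2 * (N + 1)))}, E →ₗ[ℂ] E :=
    fun t => LinearMap.id - B.comp ((M t).symm.toLinearMap.comp (A t))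
  have hP : ∀ t x, P t x = x - B ((M t).symm (A t x)) := fun t x => rfl
  let P₀ : E →ₗ[ℂ] E := LinearMap.id - B.comp A₀
  have hP₀ : ∀ x, P₀ x = x - B (A₀ x) := fun x => rfl
  refine ⟨fun t => LinearEquiv.ofLinearMap
    ((P t).restrict (p := LinearMap.ker A₀) (q := LinearMap.ker (A t)) ?_)
    (P₀.restrict (p := LinearMap.ker (A t)) (q := LinearMap.ker A₀) ?_) ?_ ?_, ?_⟩
  · intro x _
    rw [LinearMap.mem_ker, hP, map_sub, hM, sub_self]
  · intro x _
    rw [LinearMap.mem_ker, hP₀, map_sub, hB, sub_self]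
  · ext x
    have hx : A t x = 0 := x.2
    have h1 : (M t).symm (A t (B (A₀ x))) = A₀ x := (M t).symm_apply_apply _
    simp [LinearMap.restrict_apply, hP, hP₀, hx, h1]
  · ext x
    have hx : A₀ x = 0 := x.2
    simp [LinearMap.restrict_apply, hP, hP₀, hx, hB]
  · intro x l
    refine ⟨(∑ k, ‖l (B (Pi.single k 1))‖) * (2 * K x), fun t => ?_⟩
    have hx : A₀ x = 0 := x.2
    have h1 := hK x t t.2.1 (t.2.2.trans_le (min_le_left _ _))
    rw [hx, sub_zero] at h1
    set y := (M t).symm (A t x) with hy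
    have h2 := hlow t t.2.1 t.2.2 y
    rw [hy, hM, ← hy] at h2
    have e : l (P t x) - l x = - ∑ k, y k * l (B (Pi.single k 1)) := by
      have hy' : y = ∑ k, y k • (Pi.single k 1 : κ → ℂ) := by
        ext i
        simp [Finset.sum_apply, Pi.single_apply]
      rw [hP, map_sub, ← hy, sub_sub_cancel_left]
      conv_lhs => rw [hy']
      simp only [map_sum, map_smul, smul_eq_mul]
    change ‖l (P t x) - l x‖ ≤ _
    rw [e, norm_neg, Finset.sum_mul, Finset.sum_mul]
    refine (norm_sum_le _ _).trans (Finset.sum_le_sum fun k _ => ?_)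
    rw [norm_mul, mul_comm, mul_assoc]
    refine mul_le_mul_of_nonneg_left ?_ (norm_nonneg _)
    refine (norm_le_pi_norm y k).trans ?_
    linarith

end TropLine

end

noncomputable section

namespace TropLine

/-! ### Tangent directions of an ultrametric tropical line -/

lemma MinAttainedTwice.eq_of_lt {a b c : ℝ} (h : MinAttainedTwice a b c) (hab : a < b) : a = c := by
  rcases h with ⟨h, _⟩ | ⟨h, _⟩ | ⟨h, h'⟩ <;> linarith

lemma MinAttainedTwice.le_of_eq {a b c : ℝ} (h : MinAttainedTwice a b c) (hab : a = b) : a ≤ c := by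
  rcases h with ⟨h, _⟩ | ⟨h, _⟩ | ⟨h, h'⟩ <;> linarith

lemma MinAttainedTwice.not_lt_lt {a b c : ℝ} (h : MinAttainedTwice a b c) (hab : a < b) :
    ¬ a < c := fun hac => hac.ne (h.eq_of_lt hab)

variable {n : ℕ}

/-- The points at which every three-term tropical polynomial `X_i ⊕ X_j ⊕ d i j` attains its
minimum twice. -/
def minTwiceLocus (d : Fin n → Fin n → ℝ) : Set (Fin n → ℝ) :=
  {x | ∀ i j, i ≠ j → MinAttainedTwice (x i) (x j) (d i j)}

open Classical in
/-- The indices of the maximal coordinates of `x`. -/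
def argmax (x : Fin n → ℝ) : Finset (Fin n) := {i | ∀ j, x j ≤ x i}

lemma mem_argmax {x : Fin n → ℝ} {i : Fin n} : i ∈ argmax x ↔ ∀ j, x j ≤ x i := by
  simp [argmax]

lemma eq_of_mem_argmax {x : Fin n → ℝ} {i j : Fin n} (hi : i ∈ argmax x) (hj : j ∈ argmax x) :
    x i = x j := le_antisymm (mem_argmax.mp hj i) (mem_argmax.mp hi j)

lemma lt_of_notMem_argmax {x : Fin n → ℝ} {i j : Fin n} (hi : i ∈ argmax x)
    (hj : j ∉ argmax x) : x j < x i := by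
  by_contra! h
  exact hj (mem_argmax.mpr fun k => (mem_argmax.mp hi k).trans h)

lemma argmax_nonempty [NeZero n] (x : Fin n → ℝ) : (argmax x).Nonempty := by
  obtain ⟨i, hi⟩ := Finite.exists_max x
  exact ⟨i, mem_argmax.mpr hi⟩

variable {d : Fin n → Fin n → ℝ}

/-- A tangent direction `u` of the tropical line at `x` is a negative multiple of the indicator of
`argmax x`, or a positive multiple of the indicator of a class of `argmax x` of indices at mutual
distance `d > max x`. -/
lemma tangent_direction [NeZero n] {x u : Fin n → ℝ} (hx : x ∈ minTwiceLocus d) (hu : u ≠ 0)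
    {σ : ℝ} (hσ : 0 < σ) (hxu : ∀ s, 0 < s → s < σ → x + s • u ∈ minTwiceLocus d) :
    (∃ c < 0, ∀ i, u i = if i ∈ argmax x then c else 0) ∨
      ∃ c > 0, ∃ K ⊆ argmax x, K.Nonempty ∧ (∀ i, u i = if i ∈ K then c else 0) ∧
        (∀ i ∈ K, ∀ j ∈ argmax x, j ∉ K → d j i = x i) ∧
        (∀ i ∈ K, ∀ j ∈ K, i ≠ j → x i < d i j) := by
  classical
  -- While x i < x j persists, coordinate i is pinned to the constant `d i j`, so it cannot move.
  have hlt : ∀ i j, x i < x j → u i = 0 := by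
    intro i j hij
    have hne : i ≠ j := by rintro rfl; exact lt_irrefl _ hij
    have hlim : ∀ᶠ s in nhdsWithin (0 : ℝ) (Set.Ioi 0), x i + s * u i < x j + s * u j := by
      refine (ContinuousAt.eventually_lt (f := fun s : ℝ => x i + s * u i)
        (g := fun s : ℝ => x j + s * u j) (x₀ := 0) (by fun_prop) (by fun_prop)
        (by simpa using hij)).filter_mono nhdsWithin_le_nhds
    have hσ' : ∀ᶠ s in nhdsWithin (0 : ℝ) (Set.Ioi 0), s ∈ Set.Ioo 0 σ :=
      Ioo_mem_nhdsGT hσ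
    obtain ⟨s, h1, h2⟩ := (hlim.and hσ').exists
    have h3 : x i = d i j := (hx i j hne).eq_of_lt hij
    have h4 : x i + s * u i = d i j := (hxu s h2.1 h2.2 i j hne).eq_of_lt h1
    have h5 : s * u i = 0 := by linarith
    exact (mul_eq_zero.mp h5).resolve_left h2.1.ne'
  -- If two tied coordinates separate, the slower one is strictly smaller and hence equal to `d i j`
  -- for all small s; two values of s show that it stands still.
  have heq : ∀ i j, x i = x j → u i < u j → u i = 0 ∧ d i j = x i := by
    intro i j hij hu
    have hne : i ≠ j := by rintro rfl; exact lt_irrefl _ hu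
    have key : ∀ s, 0 < s → s < σ → x i + s * u i = d i j := fun s h0 h1 =>
      (hxu s h0 h1 i j hne).eq_of_lt (by
        simp only [Pi.add_apply, Pi.smul_apply, smul_eq_mul]
        rw [hij]
        have := mul_lt_mul_of_pos_left hu h0
        linarith)
    have h1 := key (σ / 2) (by linarith) (by linarith)
    have h2 := key (σ / 4) (by linarith) (by linarith)
    have h3 : σ * u i = 0 := by linarith
    have h4 := (mul_eq_zero.mp h3).resolve_left hσ.ne'
    exact ⟨h4, by rw [← h1, h4]; ring⟩
  have hout : ∀ i ∉ argmax x, u i = 0 := by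
    intro i hi
    obtain ⟨j, hj⟩ := argmax_nonempty x
    exact hlt i j (lt_of_notMem_argmax hj hi)
  obtain ⟨m, hm, hmax⟩ := Finset.exists_max_image (argmax x) u (argmax_nonempty x)
  have hcases : ∀ i ∈ argmax x, u i = u m ∨ (u i < u m ∧ u i = 0 ∧ d i m = x i) := by
    intro i hi
    rcases (hmax i hi).lt_or_eq with h | h
    · exact Or.inr ⟨h, heq i m (eq_of_mem_argmax hi hm) h⟩
    · exact Or.inl h
  -- The largest velocity `u m` decides: if negative, no maximal coordinate can stand still, so all
  -- move down together; if positive, the coordinates with this velocity form K and the other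
  -- maximal ones stand still.
  rcases lt_trichotomy (u m) 0 with hc | hc | hc
  · refine Or.inl ⟨u m, hc, fun i => ?_⟩
    split_ifs with hi
    · rcases hcases i hi with h | ⟨h, h', _⟩
      · exact h
      · linarith
    · exact hout i hi
  · refine absurd (funext fun i => ?_) hu
    by_cases hi : i ∈ argmax x
    · rcases hcases i hi with h | ⟨h, h', _⟩
      · rw [h, hc]; rfl
      · exact h'
    · exact hout i hi
  · refine Or.inr ⟨u m, hc, (argmax x).filter (fun i => u i = u m), Finset.filter_subset _ _,
      ⟨m, by simp [hm]⟩, fun i => ?_, ?_, ?_⟩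
    · by_cases hi : i ∈ argmax x
      · rcases hcases i hi with h | ⟨h, h', _⟩
        · simp [hi, h]
        · rw [if_neg (by simp [h.ne]), h']
      · rw [if_neg (by simp [hi]), hout i hi]
    · intro i hi j hj hjK
      simp only [Finset.mem_filter, not_and] at hi hjK
      have hlt' : u j < u i := by
        rw [hi.2]
        exact lt_of_le_of_ne (hmax j hj) (hjK hj)
      rw [(heq j i (eq_of_mem_argmax hj hi.1) hlt').2]
      exact eq_of_mem_argmax hj hi.1
    · intro i hi j hj hij
      simp only [Finset.mem_filter] at hi hj
      have := (hxu (σ / 2) (by linarith) (by linarith) i j hij).le_of_eq (by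
        simp only [Pi.add_apply, Pi.smul_apply, smul_eq_mul]
        rw [eq_of_mem_argmax hi.1 hj.1, hi.2, hj.2])
      simp only [Pi.add_apply, Pi.smul_apply, smul_eq_mul, hi.2] at this
      have : 0 < σ / 2 * u m := by positivity
      linarith

/-! ### Flags of a trivalent embedded curve -/

namespace TropicalCurve

variable {V F : Type*} [Fintype V] [Fintype F] (Γ : TropicalCurve n V F)

lemma dir_ne_zero (f : F) : Γ.dir f ≠ 0 := by
  intro h
  have := Γ.dir_primitive f
  rw [h, Finset.gcd_eq_zero_iff.mpr (by simp)] at this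
  exact zero_ne_one this

lemma exists_mem_openEdge (f : F) : ∃ σ : ℝ, 0 < σ ∧ ∀ s, 0 < s → s < σ →
    (Γ.pos (Γ.vert f) + s • fun i => (Γ.dir f i : ℝ)) ∈ Γ.openEdge f := by
  by_cases h : Γ.opp f = f
  · exact ⟨1, one_pos, fun s h0 _ => ⟨s, h0, fun h' => absurd h h', fun _ => rfl⟩⟩
  · exact ⟨Γ.len f, Γ.len_pos f h, fun s h0 h1 => ⟨s, h0, fun _ => h1, fun _ => rfl⟩⟩

lemma mem_openEdge_of_unbounded {f : F} (h : Γ.opp f = f) {s : ℝ} (hs : 0 < s) :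
    (Γ.pos (Γ.vert f) + s • fun i => (Γ.dir f i : ℝ)) ∈ Γ.openEdge f :=
  ⟨s, hs, fun h' => absurd h h', fun _ => rfl⟩

lemma openEdge_subset_image (f : F) : Γ.openEdge f ⊆ Γ.image :=
  fun _ hx => Or.inr (Set.mem_iUnion.mpr ⟨f, hx⟩)

variable {Γ}

/-- Two edges leaving the same point in the same direction overlap near it, which an embedding
forbids. -/
lemma eq_of_vert_eq_of_dir_eq (hemb : Γ.IsEmbedded) {f g : F} (hv : Γ.vert f = Γ.vert g)
    (hd : Γ.dir f = Γ.dir g) : f = g := by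
  by_contra hne
  obtain ⟨σ, hσ, h1⟩ := Γ.exists_mem_openEdge f
  obtain ⟨τ, hτ, h2⟩ := Γ.exists_mem_openEdge g
  have hopp : g ≠ Γ.opp f := by
    rintro rfl
    refine Γ.dir_ne_zero f (funext fun i => ?_)
    have := Γ.dir_opp f (fun h => hne h.symm) i
    rw [← hd] at this
    simp only [Pi.zero_apply]
    lia
  have hdisj := hemb.2.2 f g (fun h => hne h.symm) hopp
  set s := min σ τ / 2
  have hs : 0 < s := by positivity
  have hmin : s < min σ τ := half_lt_self (by positivity)
  refine Set.disjoint_left.mp hdisj (h1 s hs (hmin.trans_le (min_le_left _ _))) ?_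
  rw [hv, hd]
  exact h2 s hs (hmin.trans_le (min_le_right _ _))

/-- The direction of a flag is minus the indicator of the maximal coordinates, or the indicator of
one of their classes. -/
lemma dir_cases [NeZero n] (himg : Γ.image = minTwiceLocus d) (f : F) :
    (∀ i, Γ.dir f i = if i ∈ argmax (Γ.pos (Γ.vert f)) then -1 else 0) ∨
      ∃ K ⊆ argmax (Γ.pos (Γ.vert f)), K.Nonempty ∧ (∀ i, Γ.dir f i = if i ∈ K then 1 else 0) ∧
        (∀ i ∈ K, ∀ j ∈ argmax (Γ.pos (Γ.vert f)), j ∉ K → d j i = Γ.pos (Γ.vert f) i) ∧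
        (∀ i ∈ K, ∀ j ∈ K, i ≠ j → Γ.pos (Γ.vert f) i < d i j) := by
  have hx : Γ.pos (Γ.vert f) ∈ minTwiceLocus d := by
    rw [← himg]
    exact Or.inl ⟨_, rfl⟩
  obtain ⟨σ, hσ, hmem⟩ := Γ.exists_mem_openEdge f
  have hu : (fun i => (Γ.dir f i : ℝ)) ≠ 0 := by
    intro h
    refine Γ.dir_ne_zero f (funext fun i => ?_)
    simpa using congrFun h i
  -- All nonzero entries equal c, so c divides their gcd, which is 1 by primitivity.
  have hunit : ∀ (c : ℤ) (i : Fin n), Γ.dir f i = c → (∀ j, Γ.dir f j = c ∨ Γ.dir f j = 0) →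
      IsUnit c := by
    intro c i hc hall
    refine isUnit_of_dvd_one ?_
    rw [← Γ.dir_primitive f]
    refine Finset.dvd_gcd fun j _ => ?_
    rcases hall j with h | h <;> simp [h]
  rcases tangent_direction hx hu hσ (fun s h0 h1 => himg ▸ Γ.openEdge_subset_image f (hmem s h0 h1))
    with ⟨c, hc, h⟩ | ⟨c, hc, K, hK, hne, h, h1, h2⟩
  · left
    obtain ⟨m, hm⟩ := argmax_nonempty (Γ.pos (Γ.vert f))
    have hcm : (Γ.dir f m : ℝ) = c := by simpa [hm] using h m
    have hall : ∀ j, Γ.dir f j = if j ∈ argmax (Γ.pos (Γ.vert f)) then Γ.dir f m else 0 := by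
      intro j
      have := h j
      rw [← hcm] at this
      split_ifs at this ⊢ with hj
      · exact_mod_cast this
      · exact_mod_cast this
    have hdm : Γ.dir f m = -1 := by
      have h0 : Γ.dir f m < 0 := by
        rw [← hcm] at hc
        exact_mod_cast hc
      rcases Int.isUnit_iff.mp (hunit _ m rfl fun j => by rw [hall j]; split_ifs <;> simp)
        with h | h <;> lia
    simpa [hdm] using hall
  · right
    refine ⟨K, hK, hne, ?_, h1, h2⟩
    obtain ⟨m, hm⟩ := hne
    have hcm : (Γ.dir f m : ℝ) = c := by simpa [hm] using h m
    have hall : ∀ j, Γ.dir f j = if j ∈ K then Γ.dir f m else 0 := by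
      intro j
      have := h j
      rw [← hcm] at this
      split_ifs at this ⊢ with hj
      · exact_mod_cast this
      · exact_mod_cast this
    have hdm : Γ.dir f m = 1 := by
      have h0 : 0 < Γ.dir f m := by
        rw [← hcm] at hc
        exact_mod_cast hc
      rcases Int.isUnit_iff.mp (hunit _ m rfl fun j => by rw [hall j]; split_ifs <;> simp)
        with h | h <;> lia
    simpa [hdm] using hall

/-- The three flags at a vertex of a tropical line: one points down, and the other two point
towards the two classes `K` and `L` of the maximal coordinates. -/
structure Fork (Γ : TropicalCurve n V F) (d : Fin n → Fin n → ℝ) (v : V) where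
  down : F
  left : F
  right : F
  K : Finset (Fin n)
  L : Finset (Fin n)
  vert_iff : ∀ f, Γ.vert f = v ↔ f = down ∨ f = left ∨ f = right
  down_ne_left : down ≠ left
  down_ne_right : down ≠ right
  left_ne_right : left ≠ right
  K_nonempty : K.Nonempty
  L_nonempty : L.Nonempty
  disjoint : Disjoint K L
  argmax_eq : argmax (Γ.pos v) = K ∪ L
  dir_down : ∀ i, Γ.dir down i = if i ∈ K ∪ L then -1 else 0
  dir_left : ∀ i, Γ.dir left i = if i ∈ K then 1 else 0
  dir_right : ∀ i, Γ.dir right i = if i ∈ L then 1 else 0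
  dist_across : ∀ i ∈ K, ∀ j ∈ L, d i j = Γ.pos v i
  dist_left : ∀ i ∈ K, ∀ j ∈ K, i ≠ j → Γ.pos v i < d i j
  dist_right : ∀ i ∈ L, ∀ j ∈ L, i ≠ j → Γ.pos v i < d i j

lemma exists_three_flags (h3 : Γ.IsTrivalent) (v : V) : ∃ a b c, a ≠ b ∧ a ≠ c ∧ b ≠ c ∧
    ∀ f, Γ.vert f = v ↔ f = a ∨ f = b ∨ f = c := by
  classical
  have h := h3 v
  rw [Nat.card_eq_fintype_card, Fintype.card_subtype, Finset.card_eq_three] at h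
  obtain ⟨a, b, c, hab, hac, hbc, h⟩ := h
  refine ⟨a, b, c, hab, hac, hbc, fun f => ?_⟩
  have := Finset.ext_iff.mp h f
  simpa using this

lemma sum_flags {M : Type*} [AddCommMonoid M] {v : V} {a b c : F} (hab : a ≠ b) (hac : a ≠ c)
    (hbc : b ≠ c) (h : ∀ f, Γ.vert f = v ↔ f = a ∨ f = b ∨ f = c)
    [DecidablePred fun f => Γ.vert f = v] (ρ : F → M) :
    ∑ f with Γ.vert f = v, ρ f = ρ a + (ρ b + ρ c) := by
  classical
  have : (Finset.univ.filter fun f => Γ.vert f = v) = {a, b, c} := by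
    ext f
    simp [h f]
  rw [this, Finset.sum_insert (by simp [hab, hac]), Finset.sum_insert (by simp [hbc]),
    Finset.sum_singleton]

/-- Balancing excludes three nonnegative directions, so some flag points down, and embeddedness
excludes a second one. The other two directions are indicators adding up to that of the maximal
coordinates, which they therefore partition. -/
lemma nonempty_fork [NeZero n] (h3 : Γ.IsTrivalent) (hemb : Γ.IsEmbedded)
    (hwt : ∀ f, Γ.wt f = 1) (himg : Γ.image = minTwiceLocus d) (v : V) :
    Nonempty (Γ.Fork d v) := by
  classical
  have key : ∀ a b c, a ≠ b → a ≠ c → b ≠ c → (∀ f, Γ.vert f = v ↔ f = a ∨ f = b ∨ f = c) →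
      (∀ i, Γ.dir a i = if i ∈ argmax (Γ.pos (Γ.vert a)) then -1 else 0) →
      Nonempty (Γ.Fork d v) := by
    intro a b c hab hac hbc h hdown
    have hva : Γ.vert a = v := (h a).mpr (by simp)
    have hvb : Γ.vert b = v := (h b).mpr (by simp)
    have hvc : Γ.vert c = v := (h c).mpr (by simp)
    have hbal : ∀ i, Γ.dir a i + (Γ.dir b i + Γ.dir c i) = 0 := by
      intro i
      have := Γ.balanced v i
      rw [sum_flags hab hac hbc h] at this
      simpa [hwt] using this
    rw [hva] at hdown
    rcases dir_cases himg b with hb | ⟨K, hK, hKn, hb, hK1, hK2⟩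
    · rw [hvb] at hb
      exact absurd (eq_of_vert_eq_of_dir_eq hemb (hva.trans hvb.symm)
        (funext fun i => (hdown i).trans (hb i).symm)) hab
    rcases dir_cases himg c with hc | ⟨L, hL, hLn, hc, hL1, hL2⟩
    · rw [hvc] at hc
      exact absurd (eq_of_vert_eq_of_dir_eq hemb (hva.trans hvc.symm)
        (funext fun i => (hdown i).trans (hc i).symm)) hac
    rw [hvb] at hK hK1 hK2
    rw [hvc] at hL hL1 hL2
    have hmem : ∀ i, (i ∈ argmax (Γ.pos v) ↔ i ∈ K ∨ i ∈ L) ∧ ¬(i ∈ K ∧ i ∈ L) := by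
      intro i
      have := hbal i
      rw [hdown, hb, hc] at this
      have h1 : i ∈ K → i ∈ argmax (Γ.pos v) := fun h => hK h
      have h2 : i ∈ L → i ∈ argmax (Γ.pos v) := fun h => hL h
      split_ifs at this <;> simp_all
    have hdisj : Disjoint K L :=
      Finset.disjoint_left.mpr fun i hi hi' => (hmem i).2 ⟨hi, hi'⟩
    have hJ : argmax (Γ.pos v) = K ∪ L := by
      ext i
      rw [Finset.mem_union, (hmem i).1]
    refine ⟨⟨a, b, c, K, L, h, hab, hac, hbc, hKn, hLn, hdisj, hJ, ?_, hb, hc, ?_, hK2, hL2⟩⟩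
    · intro i
      rw [hdown, hJ]
    · intro i hi j hj
      rw [hL1 j hj i (hK hi) (Finset.disjoint_left.mp hdisj hi)]
      exact eq_of_mem_argmax (hL hj) (hK hi)
  obtain ⟨a, b, c, hab, hac, hbc, h⟩ := exists_three_flags h3 v
  rcases dir_cases himg a with ha | ⟨K, -, ⟨k, hk⟩, ha, -⟩
  · exact key a b c hab hac hbc h ha
  rcases dir_cases himg b with hb | ⟨L, -, -, hb, -⟩
  · exact key b a c hab.symm hbc hac (fun f => (h f).trans (by tauto)) hb
  rcases dir_cases himg c with hc | ⟨L', -, -, hc, -⟩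
  · exact key c a b hac.symm hbc.symm hab (fun f => (h f).trans (by tauto)) hc
  exfalso
  have := Γ.balanced v k
  rw [sum_flags hab hac hbc h] at this
  simp only [hwt, ha, hb, hc, hk, if_true] at this
  split_ifs at this <;> simp at this

namespace Fork

variable {v : V} (φ : Γ.Fork d v)

lemma vert_down : Γ.vert φ.down = v := (φ.vert_iff _).mpr (by simp)
lemma vert_left : Γ.vert φ.left = v := (φ.vert_iff _).mpr (by simp)
lemma vert_right : Γ.vert φ.right = v := (φ.vert_iff _).mpr (by simp)

lemma sum_eq {M : Type*} [AddCommMonoid M] [DecidablePred fun f => Γ.vert f = v] (ρ : F → M) :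
    ∑ f with Γ.vert f = v, ρ f = ρ φ.down + (ρ φ.left + ρ φ.right) :=
  sum_flags φ.down_ne_left φ.down_ne_right φ.left_ne_right φ.vert_iff ρ

lemma dir_down_eq (i : Fin n) : Γ.dir φ.down i = -(Γ.dir φ.left i + Γ.dir φ.right i) := by
  rw [φ.dir_down, φ.dir_left, φ.dir_right]
  have : i ∈ φ.K → i ∉ φ.L := fun h => Finset.disjoint_left.mp φ.disjoint h
  by_cases h1 : i ∈ φ.K <;> by_cases h2 : i ∈ φ.L <;> simp_all

lemma sum_dir_left : ∑ i, Γ.dir φ.left i = φ.K.card := by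
  simp [φ.dir_left]

lemma sum_dir_right : ∑ i, Γ.dir φ.right i = φ.L.card := by
  simp [φ.dir_right]

lemma sum_dir_down : ∑ i, Γ.dir φ.down i = -(φ.K.card + φ.L.card) := by
  simp only [dir_down_eq, Finset.sum_neg_distrib, Finset.sum_add_distrib, sum_dir_left,
    sum_dir_right]

lemma card_K_pos : 0 < φ.K.card := φ.K_nonempty.card_pos
lemma card_L_pos : 0 < φ.L.card := φ.L_nonempty.card_pos

end Fork

lemma sum_dir_opp {f : F} (h : Γ.opp f ≠ f) : ∑ i, Γ.dir (Γ.opp f) i = -∑ i, Γ.dir f i := by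
  rw [← Finset.sum_neg_distrib]
  exact Finset.sum_congr rfl fun i _ => Γ.dir_opp f h i

/-! ### Unbounded flags and induction along the tree -/

/-- An unbounded flag which does not point down has a coordinate direction. -/
lemma exists_dir_eq_single_of_unbounded (himg : Γ.image = minTwiceLocus d) (φ : ∀ v, Γ.Fork d v)
    {f : F} (hf : Γ.opp f = f) (hup : f ≠ (φ (Γ.vert f)).down) :
    ∃ j, Γ.dir f = Pi.single j 1 := by
  have key : ∀ K : Finset (Fin n), K.Nonempty → K ⊆ argmax (Γ.pos (Γ.vert f)) →
      (∀ i, Γ.dir f i = if i ∈ K then 1 else 0) → ∃ j, Γ.dir f = Pi.single j 1 := by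
    rintro K ⟨j, hj⟩ hK hdir
    refine ⟨j, funext fun i => ?_⟩
    rw [hdir, Pi.single_apply]
    by_cases hij : i = j
    · rw [hij, if_pos hj, if_pos rfl]
    rw [if_neg hij, if_neg]
    intro hi
    set x := Γ.pos (Γ.vert f)
    -- Tied coordinates are bounded by `d i j`; this parameter carries the two tied coordinates i
    -- and j past that bound.
    have hs : 0 < |d i j - x i| + 1 := by positivity
    have hmem := Γ.openEdge_subset_image f (Γ.mem_openEdge_of_unbounded hf hs)
    rw [himg] at hmem
    have h1 := (hmem i j hij).le_of_eq (by
      simp only [Pi.add_apply, Pi.smul_apply, smul_eq_mul, hdir, hi, hj, if_true]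
      exact congrArg (· + _) (eq_of_mem_argmax (hK hi) (hK hj)))
    simp only [Pi.add_apply, Pi.smul_apply, smul_eq_mul, hdir, hi, if_true] at h1
    have := le_abs_self (d i j - x i)
    push_cast at h1
    linarith
  rcases ((φ (Γ.vert f)).vert_iff f).mp rfl with h | h | h
  · exact absurd h hup
  · refine key _ (φ (Γ.vert f)).K_nonempty ?_ fun i => ?_
    · rw [(φ (Γ.vert f)).argmax_eq]
      exact Finset.subset_union_left
    · conv_lhs => rw [h]
      exact (φ (Γ.vert f)).dir_left i
  · refine key _ (φ (Γ.vert f)).L_nonempty ?_ fun i => ?_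
    · rw [(φ (Γ.vert f)).argmax_eq]
      exact Finset.subset_union_right
    · conv_lhs => rw [h]
      exact (φ (Γ.vert f)).dir_right i

/-- An unbounded flag which points down has direction `-(1, …, 1)`. -/
lemma dir_eq_neg_one_of_unbounded (himg : Γ.image = minTwiceLocus d) {v : V} (φ : Γ.Fork d v)
    (hf : Γ.opp φ.down = φ.down) (i : Fin n) : Γ.dir φ.down i = -1 := by
  rw [φ.dir_down, if_pos]
  by_contra hi
  obtain ⟨j, hj⟩ := φ.K_nonempty
  have hj : j ∈ φ.K ∪ φ.L := Finset.mem_union_left _ hj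
  have hij : j ≠ i := by rintro rfl; exact hi hj
  set x := Γ.pos v with hx
  -- Far enough down the ray, coordinate j lies strictly below both the fixed coordinate i and `d j
  -- i`, so the minimum is attained only once.
  have hs : 0 < |x j - x i| + |x j - d j i| + 1 := by positivity
  have hmem := Γ.openEdge_subset_image _ (Γ.mem_openEdge_of_unbounded hf hs)
  rw [himg, φ.vert_down, ← hx] at hmem
  have h1 := le_abs_self (x j - x i)
  have h2 := le_abs_self (x j - d j i)
  have h3 := abs_nonneg (x j - x i)
  have h4 := abs_nonneg (x j - d j i)
  refine (hmem j i hij).not_lt_lt ?_ ?_ <;>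
  · simp only [Pi.add_apply, Pi.smul_apply, smul_eq_mul, φ.dir_down, hi, hj, if_true, if_false]
    push_cast
    linarith

/-- A property of flags holds for all flags if it holds for the unbounded flags of coordinate
direction, passes to the opposite flag, and passes from the two upper flags at a vertex to the
lower one. -/
lemma flag_induction (himg : Γ.image = minTwiceLocus d) (φ : ∀ v, Γ.Fork d v) {P : F → Prop}
    (hleaf : ∀ f j, Γ.opp f = f → Γ.dir f = Pi.single j 1 → P f)
    (hopp : ∀ f, Γ.opp f ≠ f → P (Γ.opp f) → P f)
    (hdown : ∀ v, P (φ v).left → P (φ v).right → P (φ v).down) (f : F) : P f := by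
  -- Induction on the size of the class an upward flag points to. Its opposite flag has negative
  -- coordinate sum, hence points down at the next vertex, whose two classes are nonempty, have
  -- total size N, and so are smaller.
  have up : ∀ N : ℕ, ∀ f, f ≠ (φ (Γ.vert f)).down → ∑ i, Γ.dir f i = N → P f := by
    intro N
    induction N using Nat.strong_induction_on with
    | _ N ih =>
      intro f hup hN
      by_cases hf : Γ.opp f = f
      · obtain ⟨j, hj⟩ := exists_dir_eq_single_of_unbounded himg φ hf hup
        exact hleaf f j hf hj
      refine hopp f hf ?_
      set w := Γ.vert (Γ.opp f) with hw
      have hsum := sum_dir_opp hf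
      have hK := (φ w).card_K_pos
      have hL := (φ w).card_L_pos
      rcases ((φ w).vert_iff (Γ.opp f)).mp hw.symm with h | h | h
      · rw [h, (φ w).sum_dir_down, hN] at hsum
        rw [h]
        refine hdown w (ih (φ w).K.card (by lia) _ ?_ (φ w).sum_dir_left)
          (ih (φ w).L.card (by lia) _ ?_ (φ w).sum_dir_right)
        · rw [(φ w).vert_left]
          exact (φ w).down_ne_left.symm
        · rw [(φ w).vert_right]
          exact (φ w).down_ne_right.symm
      · rw [h, (φ w).sum_dir_left, hN] at hsum
        lia
      · rw [h, (φ w).sum_dir_right, hN] at hsum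
        lia
  have hl : ∀ v, P (φ v).left := fun v => up _ _ (by
    rw [(φ v).vert_left]; exact (φ v).down_ne_left.symm) (φ v).sum_dir_left
  have hr : ∀ v, P (φ v).right := fun v => up _ _ (by
    rw [(φ v).vert_right]; exact (φ v).down_ne_right.symm) (φ v).sum_dir_right
  rcases ((φ (Γ.vert f)).vert_iff f).mp rfl with h | h | h <;> rw [h]
  · exact hdown _ (hl _) (hr _)
  · exact hl _
  · exact hr _

/-- There is at most one unbounded flag of each coordinate direction. -/
lemma unbounded_flag_unique (hemb : Γ.IsEmbedded) (himg : Γ.image = minTwiceLocus d)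
    {f g : F} {j : Fin n} (hf : Γ.opp f = f) (hg : Γ.opp g = g)
    (hfd : Γ.dir f = Pi.single j 1) (hgd : Γ.dir g = Pi.single j 1) : f = g := by
  -- Far along the ray coordinate j dominates, so the other coordinates equal `d i j`. The two rays
  -- lie on one line and share the point at height `max a b + 1`.
  have key : ∀ h : F, Γ.opp h = h → Γ.dir h = Pi.single j 1 → ∀ i, i ≠ j →
      Γ.pos (Γ.vert h) i = d i j := by
    intro h hh hd i hij
    set x := Γ.pos (Γ.vert h)
    have hs : 0 < |x i - x j| + 1 := by positivity
    have hmem := Γ.openEdge_subset_image h (Γ.mem_openEdge_of_unbounded hh hs)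
    rw [himg] at hmem
    have h1 := le_abs_self (x i - x j)
    have := (hmem i j hij).eq_of_lt (by
      simp only [Pi.add_apply, Pi.smul_apply, smul_eq_mul, hd, Pi.single_eq_same,
        Pi.single_eq_of_ne hij]
      push_cast
      linarith)
    simpa [hd, Pi.single_eq_of_ne hij] using this
  by_contra hne
  have hdisj := hemb.2.2 f g (fun h => hne h.symm) (by rw [hf]; exact fun h => hne h.symm)
  set a := Γ.pos (Γ.vert f) j with ha
  set b := Γ.pos (Γ.vert g) j with hb
  have h1 := Γ.mem_openEdge_of_unbounded hf (s := max a b + 1 - a)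
    (by linarith [le_max_left a b])
  have h2 := Γ.mem_openEdge_of_unbounded hg (s := max a b + 1 - b)
    (by linarith [le_max_right a b])
  refine Set.disjoint_left.mp hdisj h1 ?_
  convert h2 using 1
  ext i
  by_cases hij : i = j
  · subst hij
    simp [hfd, hgd, ← ha, ← hb]
  · simp [hfd, hgd, Pi.single_eq_of_ne hij, key f hf hfd i hij, key g hg hgd i hij]

/-- For every coordinate direction there is an unbounded flag of that direction. -/
lemma exists_unbounded_flag (himg : Γ.image = minTwiceLocus d)
    (hsymm : ∀ i j, d i j = d j i)
    (hultra : ∀ i j k, i ≠ j → j ≠ k → i ≠ k → MinAttainedTwice (d i j) (d k j) (d i k))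
    (φ : ∀ v, Γ.Fork d v) (j : Fin n) : ∃ f, Γ.opp f = f ∧ Γ.dir f = Pi.single j 1 := by
  -- The height h exceeds all distances to j and the j-th coordinates of all vertices. By the
  -- ultrametric property the point with j-th coordinate h and other coordinates `d i j` is on the
  -- curve, and it can only be inside an edge.
  set h : ℝ := ∑ i, |d i j| + ∑ v, |Γ.pos v j| + 1 with hh
  have hd : ∀ i, d i j < h := by
    intro i
    have h1 := Finset.single_le_sum (f := fun i => |d i j|) (fun _ _ => abs_nonneg _)
      (Finset.mem_univ i)
    have h2 : 0 ≤ ∑ v, |Γ.pos v j| := Finset.sum_nonneg fun _ _ => abs_nonneg _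
    have := le_abs_self (d i j)
    linarith
  have hp : ∀ v, Γ.pos v j < h := by
    intro v
    have h1 := Finset.single_le_sum (f := fun v => |Γ.pos v j|) (fun _ _ => abs_nonneg _)
      (Finset.mem_univ v)
    have h2 : 0 ≤ ∑ i, |d i j| := Finset.sum_nonneg fun _ _ => abs_nonneg _
    have := le_abs_self (Γ.pos v j)
    linarith
  have hx : (fun i => if i = j then h else d i j) ∈ minTwiceLocus d := by
    intro i k hik
    by_cases hij : i = j
    · subst hij
      simp only [if_true, if_neg hik.symm, hsymm k i]
      exact Or.inr (Or.inr ⟨rfl, by rw [hsymm i k]; exact (hd k).le⟩)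
    · by_cases hkj : k = j
      · subst hkj
        simp only [if_true, if_neg hij]
        exact Or.inr (Or.inl ⟨rfl, (hd i).le⟩)
      · simp only [if_neg hij, if_neg hkj]
        exact hultra i j k hij (Ne.symm hkj) hik
  rw [← himg] at hx
  rcases hx with ⟨v, hv⟩ | hx
  · have := hp v
    rw [hv] at this
    simp at this
  obtain ⟨f, s, hs, hlen, hpos⟩ := Set.mem_iUnion.mp hx
  have hj := hpos j
  simp only [if_true] at hj
  have hdir : 0 < Γ.dir f j := by
    have h1 := hp (Γ.vert f)
    have h2 : 0 < s * (Γ.dir f j : ℝ) := by linarith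
    have := pos_of_mul_pos_right h2 hs.le
    exact_mod_cast this
  -- A bounded edge along which coordinate j increases would end at a vertex higher than h.
  have hopp : Γ.opp f = f := by
    by_contra hne
    have h1 := hp (Γ.vert (Γ.opp f))
    rw [Γ.pos_opp f hne, hj] at h1
    have h2 : (0 : ℝ) < Γ.dir f j := by exact_mod_cast hdir
    have := mul_lt_mul_of_pos_right (hlen hne) h2
    linarith
  refine ⟨f, hopp, ?_⟩
  obtain ⟨k, hk⟩ := exists_dir_eq_single_of_unbounded himg φ hopp (fun h => by
    have h1 := (φ (Γ.vert f)).dir_down j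
    rw [← h] at h1
    split_ifs at h1 <;> lia)
  rw [hk, Pi.single_apply] at hdir
  split_ifs at hdir with hjk
  · rw [hk, hjk]
  · exact absurd hdir (lt_irrefl _)

/-! ### Linear conditions along the tree -/

/-- A balanced family of vectors on the flags is determined linearly by its values on the unbounded
flags of coordinate direction. -/
lemma balanced_eq_sum_dir (hemb : Γ.IsEmbedded) (himg : Γ.image = minTwiceLocus d)
    (φ : ∀ v, Γ.Fork d v) {leaf : Fin n → F} (hleaf : ∀ j, Γ.opp (leaf j) = leaf j)
    (hdir : ∀ j, Γ.dir (leaf j) = Pi.single j 1) (ρ : F → ℂ)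
    (hopp : ∀ f, Γ.opp f ≠ f → ρ f + ρ (Γ.opp f) = 0)
    (hbal : ∀ v, ρ (φ v).down + (ρ (φ v).left + ρ (φ v).right) = 0) (f : F) :
    ρ f = ∑ j, (Γ.dir f j : ℂ) * ρ (leaf j) := by
  refine flag_induction himg φ (P := fun f => ρ f = ∑ j, (Γ.dir f j : ℂ) * ρ (leaf j))
    ?_ ?_ ?_ f
  · intro f j hf hfd
    rw [unbounded_flag_unique hemb himg hf (hleaf j) hfd (hdir j), hdir]
    simp [Pi.single_apply]
  · intro f hf h
    have h1 : ∑ j, (Γ.dir (Γ.opp f) j : ℂ) * ρ (leaf j) =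
        -∑ j, (Γ.dir f j : ℂ) * ρ (leaf j) := by
      rw [← Finset.sum_neg_distrib]
      refine Finset.sum_congr rfl fun j _ => ?_
      rw [Γ.dir_opp f hf]
      push_cast
      ring
    rw [h1] at h
    linear_combination hopp f hf - h
  · intro v h1 h2
    have h3 : ∑ j, (Γ.dir (φ v).down j : ℂ) * ρ (leaf j) =
        -(∑ j, (Γ.dir (φ v).left j : ℂ) * ρ (leaf j) +
          ∑ j, (Γ.dir (φ v).right j : ℂ) * ρ (leaf j)) := by
      rw [← Finset.sum_add_distrib, ← Finset.sum_neg_distrib]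
      refine Finset.sum_congr rfl fun j _ => ?_
      rw [(φ v).dir_down_eq]
      push_cast
      ring
    rw [h3, ← h1, ← h2]
    linear_combination hbal v

/-- A vector is zero if its coordinate sum and its sums over the left classes vanish. -/
lemma eq_zero_of_sum_left_eq_zero (himg : Γ.image = minTwiceLocus d) (φ : ∀ v, Γ.Fork d v)
    {leaf : Fin n → F} (hdir : ∀ j, Γ.dir (leaf j) = Pi.single j 1) (c : Fin n → ℂ)
    (hc : ∑ i, c i = 0) (hleft : ∀ v, ∑ i ∈ (φ v).K, c i = 0) (j : Fin n) : c j = 0 := by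
  -- C is the signed sum of c over the class of a flag: it changes sign across an edge and is
  -- additive at a vertex.
  let C : F → ℂ := fun f => ∑ i, (Γ.dir f i : ℂ) * c i
  have hCl : ∀ v, C (φ v).left = 0 := by
    intro v
    simpa [C, (φ v).dir_left, ite_mul] using hleft v
  have hCd : ∀ v, C (φ v).down = -(C (φ v).left + C (φ v).right) := by
    intro v
    simp only [C]
    rw [← Finset.sum_add_distrib, ← Finset.sum_neg_distrib]
    refine Finset.sum_congr rfl fun j _ => ?_
    rw [(φ v).dir_down_eq]
    push_cast
    ring
  have hCo : ∀ f, Γ.opp f ≠ f → C (Γ.opp f) = -C f := by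
    intro f hf
    simp only [C]
    rw [← Finset.sum_neg_distrib]
    refine Finset.sum_congr rfl fun j _ => ?_
    rw [Γ.dir_opp f hf]
    push_cast
    ring
  have hcard : ∀ v, (φ v).K.card + (φ v).L.card ≤ n := by
    intro v
    rw [← Finset.card_union_of_disjoint (φ v).disjoint]
    simpa using Finset.card_le_univ ((φ v).K ∪ (φ v).L)
  -- Induction on the number of indices outside the cluster of v. Following the down flag one
  -- reaches infinity, where the total sum is used, or a left flag, where the hypothesis is used, or
  -- a right flag below a strictly larger cluster, where additivity is used.
  have hdown : ∀ N v, n - ((φ v).K.card + (φ v).L.card) = N → C (φ v).down = 0 := by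
    intro N
    induction N using Nat.strong_induction_on with
    | _ N ih =>
      intro v hN
      by_cases hopp : Γ.opp (φ v).down = (φ v).down
      · have h1 := dir_eq_neg_one_of_unbounded himg (φ v) hopp
        simp [C, h1, hc]
      · rw [← neg_eq_zero, ← hCo _ hopp]
        set w := Γ.vert (Γ.opp (φ v).down) with hw
        have hsum := sum_dir_opp hopp
        rw [(φ v).sum_dir_down] at hsum
        have hK := (φ w).card_K_pos
        have hL := (φ w).card_L_pos
        have hK' := (φ v).card_K_pos
        have hL' := (φ v).card_L_pos
        have h2 := hcard w
        rcases ((φ w).vert_iff (Γ.opp (φ v).down)).mp hw.symm with h | h | h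
        · rw [h, (φ w).sum_dir_down] at hsum
          lia
        · rw [h, hCl]
        · rw [h, (φ w).sum_dir_right] at hsum
          have h3 := ih _ (by lia) w rfl
          rw [hCd, hCl, zero_add, neg_eq_zero] at h3
          rw [h, h3]
  have hall : ∀ f, C f = 0 := by
    intro f
    have h1 := hdown _ (Γ.vert f) rfl
    rcases ((φ (Γ.vert f)).vert_iff f).mp rfl with h | h | h <;> rw [h]
    · exact h1
    · exact hCl _
    · rwa [hCd, hCl, zero_add, neg_eq_zero] at h1
  simpa [C, hdir, Pi.single_apply] using hall (leaf j)

/-- The quadratic form of a matrix vanishes on all directions if and only if the diagonal vanishes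
and the sums of the symmetrized entries across the two classes at each vertex vanish. -/
lemma quadratic_dir_eq_zero_iff (himg : Γ.image = minTwiceLocus d) (φ : ∀ v, Γ.Fork d v)
    {leaf : Fin n → F} (hdir : ∀ j, Γ.dir (leaf j) = Pi.single j 1) (R : Fin n → Fin n → ℂ) :
    (∀ f, ∑ i, ∑ j, (Γ.dir f i : ℂ) * Γ.dir f j * R i j = 0) ↔
      (∀ j, R j j = 0) ∧ ∀ v, ∑ i ∈ (φ v).K, ∑ j ∈ (φ v).L, (R i j + R j i) = 0 := by
  let Q : F → ℂ := fun f => ∑ i, ∑ j, (Γ.dir f i : ℂ) * Γ.dir f j * R i j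
  have hQl : ∀ f j, Γ.dir f = Pi.single j 1 → Q f = R j j := by
    intro f j hf
    simp [Q, hf, Pi.single_apply]
  have hQo : ∀ f, Γ.opp f ≠ f → Q (Γ.opp f) = Q f := by
    intro f hf
    refine Finset.sum_congr rfl fun i _ => Finset.sum_congr rfl fun j _ => ?_
    rw [Γ.dir_opp f hf, Γ.dir_opp f hf]
    push_cast
    ring
  -- The down direction is minus the sum of the two upward ones, so Q there is Q of both plus the
  -- polarization, which is the sum across the classes.
  have hQd : ∀ v, Q (φ v).down = Q (φ v).left + Q (φ v).right +
      ∑ i ∈ (φ v).K, ∑ j ∈ (φ v).L, (R i j + R j i) := by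
    intro v
    have h1 : ∑ i ∈ (φ v).K, ∑ j ∈ (φ v).L, (R i j + R j i) =
        ∑ i, ∑ j, ((Γ.dir (φ v).left i : ℂ) * Γ.dir (φ v).right j * R i j +
          (Γ.dir (φ v).left j : ℂ) * Γ.dir (φ v).right i * R i j) := by
      simp only [Finset.sum_add_distrib]
      rw [Finset.sum_comm (s := (φ v).K) (f := fun i j => R j i)]
      congr 1
      · simp [(φ v).dir_left, (φ v).dir_right, ite_mul]
      · simp [(φ v).dir_left, (φ v).dir_right, ite_mul, mul_ite]
    rw [h1]
    simp only [Q, ← Finset.sum_add_distrib]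
    refine Finset.sum_congr rfl fun i _ => Finset.sum_congr rfl fun j _ => ?_
    rw [(φ v).dir_down_eq, (φ v).dir_down_eq]
    push_cast
    ring
  constructor
  · intro h
    refine ⟨fun j => ?_, fun v => ?_⟩
    · rw [← hQl _ j (hdir j)]
      exact h _
    · have h1 := hQd v
      have h2 : ∀ f, Q f = 0 := h
      rw [h2, h2, h2] at h1
      linear_combination -h1
  · rintro ⟨h1, h2⟩
    refine flag_induction himg φ (P := fun f => Q f = 0) ?_ ?_ ?_
    · intro f j _ hj
      rw [hQl f j hj, h1]
    · intro f hf h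
      rwa [← hQo f hf]
    · intro v hl hr
      rw [hQd, hl, hr, h2]
      simp

/-! ### Pairs of indices and the vertices separating them -/

/-- A pair of indices lies across the two classes of at most one vertex. -/
lemma vertex_unique (hemb : Γ.IsEmbedded) (himg : Γ.image = minTwiceLocus d)
    (hsymm : ∀ i j, d i j = d j i) {v w : V} (φ : Γ.Fork d v) (ψ : Γ.Fork d w) {i j : Fin n}
    (hi : i ∈ φ.K) (hj : j ∈ φ.L) (h : (i ∈ ψ.K ∧ j ∈ ψ.L) ∨ (i ∈ ψ.L ∧ j ∈ ψ.K)) : v = w := by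
  have hiv : i ∈ argmax (Γ.pos v) := by rw [φ.argmax_eq]; exact Finset.mem_union_left _ hi
  have hiw : i ∈ argmax (Γ.pos w) := by
    rw [ψ.argmax_eq, Finset.mem_union]
    tauto
  have heq : Γ.pos v i = Γ.pos w i := by
    rw [← φ.dist_across i hi j hj]
    rcases h with ⟨h1, h2⟩ | ⟨h1, h2⟩
    · exact ψ.dist_across i h1 j h2
    · rw [hsymm, ψ.dist_across j h2 i h1]
      refine eq_of_mem_argmax ?_ hiw
      rw [ψ.argmax_eq]
      exact Finset.mem_union_left _ h2
  -- A maximal coordinate i determines the whole point, its l-th coordinate being `min (x i) (d l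
  -- i)`. Both vertices have i maximal with the same value `d i j`.
  have key : ∀ u, i ∈ argmax (Γ.pos u) → ∀ l, l ≠ i → Γ.pos u l = min (Γ.pos u i) (d l i) := by
    intro u hu l hl
    have hmem : Γ.pos u ∈ minTwiceLocus d := by
      rw [← himg]
      exact Or.inl ⟨_, rfl⟩
    rcases (mem_argmax.mp hu l).lt_or_eq with h | h
    · have h1 := (hmem l i hl).eq_of_lt h
      rw [← h1, min_eq_right h.le]
    · have h1 := (hmem l i hl).le_of_eq h
      rw [← h, min_eq_left h1]
  refine hemb.1 (funext fun l => ?_)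
  by_cases hl : l = i
  · rw [hl, heq]
  · rw [key v hiv l hl, key w hiw l hl, heq]

/-- The distance of a maximal index to a non-maximal one. -/
lemma Fork.dist_outside (himg : Γ.image = minTwiceLocus d) {v : V} (φ : Γ.Fork d v)
    {i j : Fin n} (hi : i ∈ φ.K) (hj : j ∉ φ.K) (hj' : j ∉ φ.L) : d j i < Γ.pos v i := by
  have hiv : i ∈ argmax (Γ.pos v) := by rw [φ.argmax_eq]; exact Finset.mem_union_left _ hi
  have hjv : j ∉ argmax (Γ.pos v) := by simp [φ.argmax_eq, hj, hj']
  have hmem : Γ.pos v ∈ minTwiceLocus d := by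
    rw [← himg]
    exact Or.inl ⟨_, rfl⟩
  have h1 := lt_of_notMem_argmax hiv hjv
  have hne : j ≠ i := by rintro rfl; exact hj hi
  rwa [(hmem j i hne).eq_of_lt h1] at h1

end TropicalCurve
end TropLine

end

noncomputable section

namespace TropLine

open Filter Topology

/-! ### Ratios of differences of the marked points -/

lemma eventually_punctured_iff {P : ℂ → Prop} :
    (∀ᶠ t in 𝓝[≠] (0 : ℂ), P t) ↔ ∃ δ > 0, ∀ t : ℂ, 0 < ‖t‖ → ‖t‖ < δ → P t := by
  rw [Filter.Eventually, Metric.mem_nhdsWithin_iff]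
  refine exists_congr fun δ => and_congr_right fun _ => ?_
  constructor
  · intro h t h0 h1
    exact h ⟨by simpa using h1, by simpa using h0⟩
  · rintro h t ⟨h1, h0⟩
    exact h t (by simpa using h0) (by simpa using h1)

/-- The orders of the differences of the series `p i`. -/
def diffOrder {n : ℕ} (p : Fin n → LaurentSeries ℂ) (i j : Fin n) : ℝ := ((p i - p j).order : ℝ)

section Estimates

variable {n : ℕ} {p : Fin n → LaurentSeries ℂ}

lemma tropLine_eq : tropLine p = minTwiceLocus (diffOrder p) := rfl

lemma diffOrder_symm (i j : Fin n) : diffOrder p i j = diffOrder p j i := by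
  rw [diffOrder, diffOrder, ← HahnSeries.order_neg, neg_sub]

lemma diffOrder_ultrametric (hinj : Function.Injective p) (i j k : Fin n) (hij : i ≠ j)
    (hjk : j ≠ k) (hik : i ≠ k) :
    MinAttainedTwice (diffOrder p i j) (diffOrder p k j) (diffOrder p i k) := by
  have key : ∀ a b c : Fin n, a ≠ c →
      min (diffOrder p a b) (diffOrder p b c) ≤ diffOrder p a c := by
    intro a b c hac
    have h := HahnSeries.min_order_le_order_add (x := p a - p b) (y := p b - p c) (by
      rw [sub_add_sub_cancel]
      exact sub_ne_zero.mpr (hinj.ne hac))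
    rw [sub_add_sub_cancel] at h
    simp only [diffOrder]
    exact_mod_cast h
  have h1 := key i j k hik
  have h2 := key i k j hij
  have h3 := key k i j hjk.symm
  rw [diffOrder_symm j k] at h1
  rw [diffOrder_symm k i] at h3
  rw [min_le_iff] at h1 h2 h3
  unfold MinAttainedTwice
  grind

lemma injective_of_prec (hord : ∀ i j, i < j → Prec (p i) (p j)) : Function.Injective p := by
  intro i j h
  by_contra hne
  rcases lt_or_gt_of_ne hne with hlt | hlt
  · obtain ⟨k, -, h1, h2⟩ := hord i j hlt
    exact h1 (by rw [← h, h2])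
  · obtain ⟨k, -, h1, h2⟩ := hord j i hlt
    exact h1 (by rw [h, h2])

lemma exists_common_radius (hconv : ∀ i, Converges (p i)) :
    ∃ ε, 0 < ε ∧ ∀ i, ConvergesBelow ε (p i) := by
  choose ε hε h using hconv
  by_cases hn : Nonempty (Fin n)
  · obtain ⟨i₀, hi₀⟩ := Finite.exists_min ε
    exact ⟨ε i₀, hε i₀, fun i t h0 h1 => h i t h0 (h1.trans_le (hi₀ i))⟩
  · exact ⟨1, one_pos, fun i => absurd ⟨i⟩ hn⟩

lemma eventually_value_ne (hconv : ∀ i, Converges (p i)) (hinj : Function.Injective p) :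
    ∀ᶠ t in 𝓝[≠] (0 : ℂ), Function.Injective fun i => value (p i) t := by
  obtain ⟨ε, hε, h⟩ := exists_common_radius hconv
  have key : ∀ i j, ∀ᶠ t in 𝓝[≠] (0 : ℂ), i ≠ j → value (p i) t ≠ value (p j) t := by
    intro i j
    by_cases hij : i = j
    · exact Filter.Eventually.of_forall fun t h => absurd hij h
    obtain ⟨δ, hδ, c, hc, hb⟩ := ((h i).sub (h j)).le_norm_value hε
      (sub_ne_zero.mpr (hinj.ne hij))
    refine eventually_punctured_iff.mpr ⟨min ε δ, by positivity, fun t h0 h1 _ heq => ?_⟩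
    have h2 := hb t h0 (h1.trans_le (min_le_right _ _))
    rw [(h i).value_sub (h j) h0 (h1.trans_le (min_le_left _ _)), heq, sub_self, norm_zero] at h2
    have : 0 < c * ‖t‖ ^ (p i - p j).order := by positivity
    linarith
  filter_upwards [eventually_all.mpr fun i => eventually_all.mpr (key i)] with t ht i j hij
  by_contra hne
  exact ht i j hne hij

lemma vanishBelow_sub {i j : Fin n} {N : ℤ} (h : i ≠ j → (N : ℝ) ≤ diffOrder p i j) :
    VanishBelow N (p i - p j) := by
  by_cases hij : i = j
  · rw [hij, sub_self]
    exact VanishBelow.zero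
  · refine VanishBelow.of_order ?_
    have := h hij
    unfold diffOrder at this
    exact_mod_cast this

/-- The numerator has order equal to the maximal coordinate at v. If i is in L, the denominator has
this order too and differs from the numerator by differences inside K and inside L, which have
larger order. If i is outside both classes, the denominator has strictly smaller order. -/
lemma exists_ratio_bound {V F : Type*} [Fintype V] [Fintype F] {Γ : TropicalCurve n V F}
    (hconv : ∀ i, Converges (p i)) (hinj : Function.Injective p)
    (himg : Γ.image = minTwiceLocus (diffOrder p)) {v : V} (φ : Γ.Fork (diffOrder p) v)
    {k l i j : Fin n} (hk : k ∈ φ.K) (hl : l ∈ φ.L) (hj : j ∈ φ.K) (hi : i ∉ φ.K) :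
    ∃ C, ∀ᶠ t in 𝓝[≠] (0 : ℂ),
      ‖(value (p k) t - value (p l) t) / (value (p j) t - value (p i) t) -
        if i ∈ φ.L then 1 else 0‖ ≤ C * ‖t‖ := by
  obtain ⟨ε, hε, h⟩ := exists_common_radius hconv
  have hij : j ≠ i := by rintro rfl; exact hi hj
  have hne : p j - p i ≠ 0 := sub_ne_zero.mpr (hinj.ne hij)
  have hJ : ∀ a ∈ φ.K, a ∈ argmax (Γ.pos v) := fun a ha => by
    rw [φ.argmax_eq]; exact Finset.mem_union_left _ ha
  have hJ' : ∀ a ∈ φ.L, a ∈ argmax (Γ.pos v) := fun a ha => by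
    rw [φ.argmax_eq]; exact Finset.mem_union_right _ ha
  -- Orders are integers, so a strict inequality gains a full factor of t.
  have hlt : ∀ {N : ℤ} {x : ℝ} {q : LaurentSeries ℂ}, (N : ℝ) = x → x < (q.order : ℝ) →
      ((N + 1 : ℤ) : ℝ) ≤ (q.order : ℝ) := by
    intro N x q h1 h2
    rw [← h1] at h2
    have h3 : N < q.order := by exact_mod_cast h2
    exact_mod_cast h3
  by_cases hiL : i ∈ φ.L
  · have hd : ((p j - p i).order : ℝ) = Γ.pos v j := φ.dist_across j hj i hiL
    have hv : VanishBelow ((p j - p i).order + 1) (p k - p j - (p l - p i)) := by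
      refine (vanishBelow_sub fun hkj => ?_).sub (vanishBelow_sub fun hli => ?_)
      · refine hlt hd ?_
        rw [← eq_of_mem_argmax (hJ k hk) (hJ j hj)]
        exact φ.dist_left k hk j hj hkj
      · refine hlt hd ?_
        rw [← eq_of_mem_argmax (hJ' l hl) (hJ j hj)]
        exact φ.dist_right l hl i hiL hli
    obtain ⟨δ, hδ, C, hC⟩ := exists_norm_value_div_le hε
      (((h k).sub (h j)).sub ((h l).sub (h i))) ((h j).sub (h i)) hne hv
    refine ⟨C, ?_⟩
    have hev := eventually_punctured_iff.mpr ⟨min δ ε, by positivity, fun t h0 h1 =>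
      And.intro (hC t h0 (h1.trans_le (min_le_left _ _)))
        (And.intro h0 (h1.trans_le (min_le_right _ _)))⟩
    filter_upwards [hev, eventually_value_ne hconv hinj] with t ⟨h1, h2, h3⟩ h4
    rw [((h k).sub (h j)).value_sub ((h l).sub (h i)) h2 h3, (h k).value_sub (h j) h2 h3,
      (h l).value_sub (h i) h2 h3, (h j).value_sub (h i) h2 h3] at h1
    have h5 : value (p j) t - value (p i) t ≠ 0 := sub_ne_zero.mpr (h4.ne hij)
    rw [if_pos hiL]
    convert h1 using 2
    field_simp
    ring
  · have hd : ((p k - p l).order : ℝ) = Γ.pos v k := φ.dist_across k hk l hl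
    have hd' : ((p j - p i).order : ℝ) < Γ.pos v k := by
      have := φ.dist_outside himg hj hi hiL
      rw [diffOrder_symm, eq_of_mem_argmax (hJ j hj) (hJ k hk)] at this
      exact this
    have hv : VanishBelow ((p j - p i).order + 1) (p k - p l) := by
      refine vanishBelow_sub fun _ => hlt rfl ?_
      rw [hd]
      exact hd'
    obtain ⟨δ, hδ, C, hC⟩ := exists_norm_value_div_le hε ((h k).sub (h l)) ((h j).sub (h i)) hne hv
    refine ⟨C, eventually_punctured_iff.mpr ⟨min δ ε, by positivity, fun t h0 h1 => ?_⟩⟩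
    have h2 := hC t h0 (h1.trans_le (min_le_left _ _))
    have h3 := h1.trans_le (min_le_right _ _)
    rw [(h k).value_sub (h l) h0 h3, (h j).value_sub (h i) h0 h3] at h2
    rwa [if_neg hiL, sub_zero]

end Estimates

/-! ### Sections on the line -/

section Line

variable {n : ℕ}

/-- The residue at `a j` of the quadratic differential `∑ R j i dz² / ((z - a j) (z - a i))`, up to
the contribution of the diagonal of `R`. -/
def simpleResidue (a : Fin n → ℂ) (R : Fin n → Fin n → ℂ) (j : Fin n) : ℂ :=
  ∑ i, (R i j + R j i) / (a j - a i)

/-- The summand is antisymmetric in the two indices, so the pairs inside K cancel. -/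
lemma sum_simpleResidue (a : Fin n → ℂ) (R : Fin n → Fin n → ℂ) (K : Finset (Fin n)) :
    ∑ j ∈ K, simpleResidue a R j =
      ∑ j ∈ K, ∑ i ∈ Kᶜ, (R i j + R j i) / (a j - a i) := by
  have h1 : ∑ j ∈ K, ∑ i ∈ K, (R i j + R j i) / (a j - a i) = 0 := by
    have h2 : ∑ j ∈ K, ∑ i ∈ K, (R i j + R j i) / (a j - a i) =
        -∑ j ∈ K, ∑ i ∈ K, (R i j + R j i) / (a j - a i) := by
      conv_lhs => rw [Finset.sum_comm]
      simp only [← Finset.sum_neg_distrib]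
      refine Finset.sum_congr rfl fun i _ => Finset.sum_congr rfl fun j _ => ?_
      rw [← div_neg, neg_sub, add_comm]
    exact self_eq_neg.mp h2
  simp only [simpleResidue, ← Finset.sum_add_sum_compl K, Finset.sum_add_distrib, h1, zero_add]

lemma sum_univ_simpleResidue (a : Fin n → ℂ) (R : Fin n → Fin n → ℂ) :
    ∑ j, simpleResidue a R j = 0 := by
  rw [sum_simpleResidue]
  simp

lemma eta_mul_eta {a b : ℂ} (hab : a ≠ b) :
    eta (OnePoint.some a) * eta (OnePoint.some b) =
      (a - b)⁻¹ • (eta (OnePoint.some a) - eta (OnePoint.some b)) := by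
  have h1 := X_sub_C_ne_zero a
  have h2 := X_sub_C_ne_zero b
  have h3 : (RatFunc.C a - RatFunc.C b : RatFunc ℂ) ≠ 0 := by
    rw [← map_sub]
    exact (map_ne_zero _).mpr (sub_ne_zero.mpr hab)
  simp only [eta, RatFunc.smul_eq_C_mul, map_inv₀, map_sub]
  field_simp
  ring

/-- Partial fractions for each product of two distinct poles; the zero diagonal removes the double
poles. -/
lemma sum_smul_eta_mul_eta {a : Fin n → ℂ} (ha : Function.Injective a)
    {R : Fin n → Fin n → ℂ} (hR : ∀ j, R j j = 0) :
    ∑ i, (∑ j, R j i • eta (OnePoint.some (a j))) * eta (OnePoint.some (a i)) =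
      ∑ j, simpleResidue a R j • eta (OnePoint.some (a j)) := by
  have h1 : ∀ i j, R j i • eta (OnePoint.some (a j)) * eta (OnePoint.some (a i)) =
      (R j i / (a j - a i)) • eta (OnePoint.some (a j)) -
        (R j i / (a j - a i)) • eta (OnePoint.some (a i)) := by
    intro i j
    by_cases hij : j = i
    · simp [hij, hR]
    · rw [smul_mul_assoc, eta_mul_eta (ha.ne hij), smul_smul, ← smul_sub, div_eq_mul_inv]
  simp only [Finset.sum_mul, h1, Finset.sum_sub_distrib]
  rw [Finset.sum_comm]
  rw [← Finset.sum_sub_distrib]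
  refine Finset.sum_congr rfl fun j _ => ?_
  rw [← Finset.sum_smul, ← Finset.sum_smul, ← sub_smul, ← Finset.sum_sub_distrib, simpleResidue]
  congr 1
  refine Finset.sum_congr rfl fun i _ => ?_
  rw [← neg_sub (a j) (a i), div_neg]
  ring

lemma residue_sum_eta_coe {a : Fin n → ℂ} (ha : Function.Injective a) (c : Fin n → ℂ)
    (j : Fin n) :
    residue (OnePoint.some (a j)) (∑ i, c i • eta (OnePoint.some (a i))) = c j := by
  classical
  simp [residue_sum, residue_smul, residue_eta, ha.eq_iff]

lemma quadratic_eta_eq_zero_iff {a : Fin n → ℂ} (ha : Function.Injective a)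
    (R : Fin n → Fin n → ℂ) :
    ∑ i, (∑ j, R j i • eta (OnePoint.some (a j))) * eta (OnePoint.some (a i)) = 0 ↔
      (∀ j, R j j = 0) ∧ ∀ j, simpleResidue a R j = 0 := by
  classical
  constructor
  · intro h
    have hdiag : ∀ j, R j j = 0 := by
      intro j
      have hv : ∀ i, VanishBelow (-1) (expandForm (OnePoint.some (a j))
          (∑ k, R k i • eta (OnePoint.some (a k)))) := by
        intro i
        rw [expandForm_sum]
        refine VanishBelow.sum _ fun l _ => ?_
        rw [expandForm_smul]
        exact (vanishBelow_expandForm_eta _ _).smul _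
      have h1 := sum_residue_mul_eq_zero (OnePoint.some (a j)) _ _ hv
        (fun i => vanishBelow_expandForm_eta _ _) h
      simpa [residue_sum_eta_coe ha, residue_eta, ha.eq_iff] using h1
    refine ⟨hdiag, fun j => ?_⟩
    rw [sum_smul_eta_mul_eta ha hdiag] at h
    rw [← residue_sum_eta_coe ha (simpleResidue a R) j, h, residue_zero]
  · rintro ⟨h1, h2⟩
    rw [sum_smul_eta_mul_eta ha h1]
    simp [h2]

end Line

lemma dlog_algebraMap (P : Polynomial ℂ) : dlog (algebraMap (Polynomial ℂ) (RatFunc ℂ) P) =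
    algebraMap (Polynomial ℂ) (RatFunc ℂ) (Polynomial.derivative P) /
      algebraMap (Polynomial ℂ) (RatFunc ℂ) P := by
  simp [dlog]

/-! ### Sections on the line as matrices of residues -/

section LineSections

variable {r : ℕ} {p : Fin (r + 1) → LaurentSeries ℂ} {t : ℂ}

/-- The sign in p_i - X does not affect the logarithmic derivative, and `p 0 = 0` brings the
coordinate X itself into the same form. -/
lemma dlog_lineCurve_coord (hp0 : p 0 = 0) (i : Fin (r + 1)) :
    dlog ((lineCurve p t).coord () i) = eta (OnePoint.some (value (p i) t)) := by
  have hv : value (p 0) t = 0 := by simp [hp0, value]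
  by_cases hi : i = 0
  · subst hi
    have : (lineCurve p t).coord () 0 = algebraMap (Polynomial ℂ) (RatFunc ℂ) Polynomial.X := by
      simp [lineCurve]
    rw [this, dlog_algebraMap, hv]
    simp [eta]
  · have : (lineCurve p t).coord () i = algebraMap (Polynomial ℂ) (RatFunc ℂ)
        (Polynomial.C (value (p i) t) - Polynomial.X) := by
      simp [lineCurve, hi]
    rw [this, dlog_algebraMap]
    simp only [eta, Polynomial.derivative_C, Polynomial.derivative_X, map_sub, map_neg, map_one,
      zero_sub, RatFunc.algebraMap_C, RatFunc.algebraMap_X]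
    have h1 := X_sub_C_ne_zero (value (p i) t)
    rw [← neg_sub RatFunc.X]
    field_simp

lemma lineCurve_pt_injective (ha : Function.Injective fun i => value (p i) t) :
    Function.Injective (lineCurve p t).pt := by
  rintro (_ | i) (_ | j) h
  · rfl
  · exact absurd h (OnePoint.infty_ne_coe _)
  · exact absurd h (OnePoint.coe_ne_infty _)
  · have : value (p i) t = value (p j) t := OnePoint.coe_injective h
    rw [ha this]

/-- The forms on the line with residues `R j i` at the points `p j`. -/
def lineForms (p : Fin (r + 1) → LaurentSeries ℂ) (t : ℂ) :
    (Fin (r + 1) → Fin (r + 1) → ℂ) →ₗ[ℂ] Unit → Fin (r + 1) → RatFunc ℂ where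
  toFun R := fun _ i => ∑ j, R j i • eta (OnePoint.some (value (p j) t))
  map_add' R R' := by
    ext _ i : 2
    simp [add_smul, Finset.sum_add_distrib]
  map_smul' c R := by
    ext _ i : 2
    simp [mul_smul, Finset.smul_sum]

lemma lineForms_apply (R : Fin (r + 1) → Fin (r + 1) → ℂ) (u : Unit) (i : Fin (r + 1)) :
    lineForms p t R u i = ∑ j, R j i • eta (OnePoint.some (value (p j) t)) := rfl

/-- The residues at all marked points of the line, from those at the finite points. -/
def lineResidue (R : Fin (r + 1) → Fin (r + 1) → ℂ) (i : Fin (r + 1)) : Option (Fin (r + 1)) → ℂ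
  | none => -∑ j, R j i
  | some j => R j i

lemma sum_lineResidue (R : Fin (r + 1) → Fin (r + 1) → ℂ) (i : Fin (r + 1)) :
    ∑ g, lineResidue R i g = 0 := by
  simp [Fintype.sum_option, lineResidue]

lemma lineForms_eq (R : Fin (r + 1) → Fin (r + 1) → ℂ) (u : Unit) (i : Fin (r + 1)) :
    lineForms p t R u i = ∑ g, lineResidue R i g • eta ((lineCurve p t).pt g) := by
  have h : eta ((lineCurve p t).pt none) = 0 := rfl
  rw [Fintype.sum_option, h, smul_zero, zero_add]
  rfl

lemma residue_lineForms (ha : Function.Injective fun i => value (p i) t)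
    (R : Fin (r + 1) → Fin (r + 1) → ℂ) (i : Fin (r + 1)) (g : Option (Fin (r + 1))) :
    residue ((lineCurve p t).pt g) (lineForms p t R () i) = lineResidue R i g := by
  rw [lineForms_eq]
  exact residue_sum_eta (lineCurve_pt_injective ha) _ (sum_lineResidue R i) g

lemma isLogForm_lineForms (R : Fin (r + 1) → Fin (r + 1) → ℂ) (i : Fin (r + 1)) :
    IsLogForm (lineCurve p t).pt (lineForms p t R () i) := by
  rw [lineForms_eq]
  exact isLogForm_sum_eta _ (sum_lineResidue R i)

lemma isLogForm_of_mem_lineSections {ω : Unit → Fin (r + 1) → RatFunc ℂ}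
    (h : ω ∈ (lineCurve p t).dualObstructionSections) (i : Fin (r + 1)) :
    IsLogForm (lineCurve p t).pt (ω () i) :=
  ⟨fun x hx => h.1 () i x fun f _ => hx f, fun k => h.2.1 k i⟩

lemma lineForms_mem_iff (hp0 : p 0 = 0) (ha : Function.Injective fun i => value (p i) t)
    (R : Fin (r + 1) → Fin (r + 1) → ℂ) :
    lineForms p t R ∈ (lineCurve p t).dualObstructionSections ↔
      (∀ j, R j j = 0) ∧ ∀ j, simpleResidue (fun i => value (p i) t) R j = 0 := by
  rw [← quadratic_eta_eq_zero_iff ha]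
  constructor
  · intro h
    have := h.2.2.2 ()
    simpa only [dlog_lineCurve_coord hp0, lineForms_apply] using this
  · intro h
    refine ⟨fun v i x hx => ?_, fun f i => ?_, fun f hf => absurd rfl hf, fun v => ?_⟩
    · exact (isLogForm_lineForms R i).1 x fun f => hx f rfl
    · exact (isLogForm_lineForms R i).2 f
    · simpa only [dlog_lineCurve_coord hp0, lineForms_apply] using h

/-- The sections on the line correspond to matrices of residues. -/
lemma exists_lineSections_equiv (hp0 : p 0 = 0) (ha : Function.Injective fun i => value (p i) t)
    (W : Submodule ℂ (Fin (r + 1) → Fin (r + 1) → ℂ))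
    (hW : ∀ R, R ∈ W ↔
      (∀ j, R j j = 0) ∧ ∀ j, simpleResidue (fun i => value (p i) t) R j = 0) :
    ∃ Ψ : W ≃ₗ[ℂ] (lineCurve p t).dualObstructionSections, ∀ (R : W) (i : Fin (r + 1)) g,
      residue ((lineCurve p t).pt g) ((Ψ R : Unit → Fin (r + 1) → RatFunc ℂ) () i) =
        lineResidue R i g := by
  let ψ : W →ₗ[ℂ] (lineCurve p t).dualObstructionSections :=
    (lineForms p t).restrict fun R hR => (lineForms_mem_iff hp0 ha R).mpr ((hW R).mp hR)
  have hψ : ∀ R : W, (ψ R : Unit → Fin (r + 1) → RatFunc ℂ) = lineForms p t R := fun R => rfl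
  have hbij : Function.Bijective ψ := by
    constructor
    · rw [injective_iff_map_eq_zero]
      intro R hR
      ext j i
      have h1 := residue_lineForms ha R i (some j)
      rw [← hψ, hR] at h1
      exact h1.symm.trans (residue_zero _)
    · rintro ⟨ω, hω⟩
      set R : Fin (r + 1) → Fin (r + 1) → ℂ :=
        fun j i => residue ((lineCurve p t).pt (some j)) (ω () i) with hR
      have heq : lineForms p t R = ω := by
        ext u i : 2
        have h1 := (isLogForm_of_mem_lineSections hω i).eq_sum_eta (lineCurve_pt_injective ha)
        have h : eta ((lineCurve p t).pt none) = 0 := rfl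
        rw [Fintype.sum_option, h, smul_zero, zero_add] at h1
        exact h1.symm
      have hmem : R ∈ W := by
        rw [hW, ← lineForms_mem_iff hp0 ha, heq]
        exact hω
      exact ⟨⟨R, hmem⟩, Subtype.ext heq⟩
  refine ⟨LinearEquiv.ofBijective ψ hbij, fun R i g => ?_⟩
  exact residue_lineForms ha R i g

end LineSections
end TropLine

end

noncomputable section

namespace TropLine

/-! ### Sections on the pre-log curve -/

section PreLog

variable {n : ℕ} {V F : Type*} [Fintype V] [Fintype F] {Γ : TropicalCurve n V F}
  {D : ToricCurve n Γ.toFlagGraph} {d : Fin n → Fin n → ℝ}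

lemma TropicalCurve.Fork.sum_subtype {M : Type*} [AddCommMonoid M] {v : V} (φ : Γ.Fork d v)
    [Fintype {f // Γ.vert f = v}] (ρ : F → M) :
    ∑ f : {f // Γ.vert f = v}, ρ f = ρ φ.down + (ρ φ.left + ρ φ.right) := by
  classical
  rw [← φ.sum_eq, Finset.sum_subtype (p := fun f => Γ.vert f = v) _ (by simp)]

/-- The marked points on the component `v`. -/
def ToricCurve.componentPt (D : ToricCurve n Γ.toFlagGraph) (v : V) :
    {f // Γ.vert f = v} → OnePoint ℂ := fun f => D.pt f

lemma componentPt_injective (hD : D.IsPreLogOfType Γ) (v : V) :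
    Function.Injective (D.componentPt v) := fun f g h =>
  Subtype.ext (hD.pt_injective f g (f.2.trans g.2.symm) h)

lemma isLogForm_of_mem_sections {s : V → Fin n → RatFunc ℂ} (hs : s ∈ D.dualObstructionSections)
    (v : V) (i : Fin n) : IsLogForm (D.componentPt v) (s v i) := by
  refine ⟨fun x hx => hs.1 v i x fun f hf => hx ⟨f, hf⟩, ?_⟩
  rintro ⟨f, rfl⟩
  exact hs.2.1 f i

lemma isLogForm_dlog_coord (hD : D.IsPreLogOfType Γ) (v : V) (i : Fin n) :
    IsLogForm (D.componentPt v) (dlog (D.coord v i)) :=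
  isLogForm_dlog (hD.coord_ne_zero v i) fun x hx =>
    hD.order_unmarked v i x fun f hf => hx ⟨f, hf⟩

lemma residue_dlog_coord (hD : D.IsPreLogOfType Γ) (hwt : ∀ f, Γ.wt f = 1) (f : F) (i : Fin n) :
    residue (D.pt f) (dlog (D.coord (Γ.vert f) i)) = Γ.dir f i := by
  rw [residue_dlog (hD.coord_ne_zero _ i), hD.order_marked, hwt]
  simp

/-- The residues of a section annihilate the directions of the flags. -/
lemma sum_residue_mul_dir (hD : D.IsPreLogOfType Γ) (hwt : ∀ f, Γ.wt f = 1)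
    {s : V → Fin n → RatFunc ℂ} (hs : s ∈ D.dualObstructionSections) (f : F) :
    ∑ i, residue (D.pt f) (s (Γ.vert f) i) * Γ.dir f i = 0 := by
  have h := sum_residue_mul_eq_zero (D.pt f) (s (Γ.vert f)) _
    (fun i => (isLogForm_of_mem_sections hs _ i).vanishBelow _)
    (fun i => (isLogForm_dlog_coord hD _ i).vanishBelow _) (hs.2.2.2 (Γ.vert f))
  simpa only [residue_dlog_coord hD hwt] using h

/-- With x and y spanning the logarithmic forms on a three-pointed component, the pairing is a
combination of x², y² and xy. The three equations, one per marked point, kill the three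
coefficients. -/
lemma sum_pairing_eq_zero {x y : RatFunc ℂ} {ρ ρ' e e' : Fin n → ℂ}
    (h1 : ∑ i, ρ i * e i = 0) (h2 : ∑ i, ρ' i * e' i = 0)
    (h3 : ∑ i, (ρ i + ρ' i) * (e i + e' i) = 0) :
    ∑ i, (ρ i • x + ρ' i • y) * (e i • x + e' i • y) = 0 := by
  have h4 : ∑ i, (ρ i * e' i + ρ' i * e i) = 0 := by
    have : ∑ i, (ρ i + ρ' i) * (e i + e' i) =
        ∑ i, ρ i * e i + ∑ i, ρ' i * e' i + ∑ i, (ρ i * e' i + ρ' i * e i) := by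
      simp only [← Finset.sum_add_distrib]
      exact Finset.sum_congr rfl fun i _ => by ring
    rw [h1, h2, h3] at this
    simpa using this.symm
  have h5 : ∑ i, (ρ i • x + ρ' i • y) * (e i • x + e' i • y) =
      (∑ i, ρ i * e i) • (x * x) + (∑ i, ρ' i * e' i) • (y * y) +
        (∑ i, (ρ i * e' i + ρ' i * e i)) • (x * y) := by
    simp only [Finset.sum_smul, ← Finset.sum_add_distrib]
    refine Finset.sum_congr rfl fun i _ => ?_
    simp only [RatFunc.smul_eq_C_mul, map_mul, map_add]
    ring
  rw [h5, h1, h2, h4]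
  simp

open Classical in
/-- The forms on the components with residues `∑ dir f j * R j i` at the marked points. -/
def componentForms (D : ToricCurve n Γ.toFlagGraph) (R : Fin n → Fin n → ℂ) :
    V → Fin n → RatFunc ℂ := fun v i =>
  ∑ f : {f // Γ.vert f = v}, (∑ j, (Γ.dir f j : ℂ) * R j i) • eta (D.componentPt v f)

lemma sum_flags_dir_mul (φ : ∀ v, Γ.Fork d v) (R : Fin n → Fin n → ℂ) (v : V) (i : Fin n)
    [Fintype {f // Γ.vert f = v}] :
    ∑ f : {f // Γ.vert f = v}, ∑ j, (Γ.dir f j : ℂ) * R j i = 0 := by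
  rw [(φ v).sum_subtype (fun f => ∑ j, (Γ.dir f j : ℂ) * R j i)]
  simp only [← Finset.sum_add_distrib]
  refine Finset.sum_eq_zero fun j _ => ?_
  rw [(φ v).dir_down_eq]
  push_cast
  ring

lemma residue_componentForms (hD : D.IsPreLogOfType Γ) (φ : ∀ v, Γ.Fork d v)
    (R : Fin n → Fin n → ℂ) (f : F) (i : Fin n) :
    residue (D.pt f) (componentForms D R (Γ.vert f) i) = ∑ j, (Γ.dir f j : ℂ) * R j i := by
  classical
  exact residue_sum_eta (componentPt_injective hD (Γ.vert f)) _
    (sum_flags_dir_mul φ R (Γ.vert f) i) ⟨f, rfl⟩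

lemma componentForms_mem (hD : D.IsPreLogOfType Γ) (hwt : ∀ f, Γ.wt f = 1)
    (φ : ∀ v, Γ.Fork d v) {R : Fin n → Fin n → ℂ}
    (hR : ∀ f, ∑ i, ∑ j, (Γ.dir f i : ℂ) * Γ.dir f j * R i j = 0) :
    componentForms D R ∈ D.dualObstructionSections := by
  classical
  have hlog : ∀ v i, IsLogForm (D.componentPt v) (componentForms D R v i) := fun v i =>
    isLogForm_sum_eta _ (sum_flags_dir_mul φ R v i)
  refine ⟨fun v i x hx => (hlog v i).1 x fun f => hx f f.2, fun f i => (hlog _ i).2 ⟨f, rfl⟩,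
    fun f hf i => ?_, fun v => ?_⟩
  · rw [residue_componentForms hD φ, residue_componentForms hD φ, ← Finset.sum_add_distrib]
    refine Finset.sum_eq_zero fun j _ => ?_
    rw [Γ.dir_opp f hf]
    push_cast
    ring
  · have hpair : ∀ f, ∑ i, (∑ j, (Γ.dir f j : ℂ) * R j i) * Γ.dir f i = 0 := by
      intro f
      rw [← hR f, Finset.sum_comm]
      refine Finset.sum_congr rfl fun i _ => ?_
      rw [Finset.sum_mul]
      exact Finset.sum_congr rfl fun j _ => by ring
    -- Residues at the three flags sum to zero, so the one at the down flag can be eliminated,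
    -- leaving two basic forms.
    have hω : ∀ i, componentForms D R v i =
        (∑ j, (Γ.dir (φ v).left j : ℂ) * R j i) •
            (eta (D.pt (φ v).left) - eta (D.pt (φ v).down)) +
          (∑ j, (Γ.dir (φ v).right j : ℂ) * R j i) •
            (eta (D.pt (φ v).right) - eta (D.pt (φ v).down)) := by
      intro i
      have h1 : componentForms D R v i = _ := (φ v).sum_subtype
        (fun f => (∑ j, (Γ.dir f j : ℂ) * R j i) • eta (D.pt f))
      have h2 := sum_flags_dir_mul φ R v i
      rw [(φ v).sum_subtype (fun f => ∑ j, (Γ.dir f j : ℂ) * R j i)] at h2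
      rw [h1, eq_neg_of_add_eq_zero_left h2]
      module
    have hη : ∀ i, dlog (D.coord v i) =
        (Γ.dir (φ v).left i : ℂ) • (eta (D.pt (φ v).left) - eta (D.pt (φ v).down)) +
          (Γ.dir (φ v).right i : ℂ) • (eta (D.pt (φ v).right) - eta (D.pt (φ v).down)) := by
      intro i
      have h1 := (isLogForm_dlog_coord hD v i).eq_sum_eta (componentPt_injective hD v)
      have h2 : ∀ f : {f // Γ.vert f = v},
          residue (D.componentPt v f) (dlog (D.coord v i)) = Γ.dir f i := by
        rintro ⟨f, rfl⟩
        exact residue_dlog_coord hD hwt f i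
      simp only [h2] at h1
      rw [h1]
      refine ((φ v).sum_subtype (fun f => (Γ.dir f i : ℂ) • eta (D.pt f))).trans ?_
      rw [(φ v).dir_down_eq]
      push_cast
      module
    simp only [hω, hη]
    refine sum_pairing_eq_zero (hpair _) (hpair _) ?_
    rw [← hpair (φ v).down]
    refine Finset.sum_congr rfl fun i _ => ?_
    have h3 : ∑ j, (Γ.dir (φ v).down j : ℂ) * R j i =
        -(∑ j, (Γ.dir (φ v).left j : ℂ) * R j i + ∑ j, (Γ.dir (φ v).right j : ℂ) * R j i) := by
      rw [← Finset.sum_add_distrib, ← Finset.sum_neg_distrib]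
      refine Finset.sum_congr rfl fun j _ => ?_
      rw [(φ v).dir_down_eq]
      push_cast
      ring
    rw [h3, (φ v).dir_down_eq]
    push_cast
    ring

/-- The sections on a pre-log curve correspond to matrices of residues at the unbounded edges. -/
lemma exists_sections_equiv (hD : D.IsPreLogOfType Γ) (hwt : ∀ f, Γ.wt f = 1)
    (hemb : Γ.IsEmbedded) (himg : Γ.image = minTwiceLocus d) (φ : ∀ v, Γ.Fork d v)
    {leaf : Fin n → F} (hleaf : ∀ j, Γ.opp (leaf j) = leaf j)
    (hdir : ∀ j, Γ.dir (leaf j) = Pi.single j 1) (W : Submodule ℂ (Fin n → Fin n → ℂ))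
    (hW : ∀ R, R ∈ W ↔ ∀ f, ∑ i, ∑ j, (Γ.dir f i : ℂ) * Γ.dir f j * R i j = 0) :
    ∃ Ψ : D.dualObstructionSections ≃ₗ[ℂ] W, ∀ (s : D.dualObstructionSections) f i,
      residue (D.pt f) ((s : V → Fin n → RatFunc ℂ) (Γ.vert f) i) =
        ∑ j, (Γ.dir f j : ℂ) * (Ψ s : Fin n → Fin n → ℂ) j i := by
  classical
  let ψ₀ : (V → Fin n → RatFunc ℂ) →ₗ[ℂ] Fin n → Fin n → ℂ :=
    { toFun := fun s j i => residue (D.pt (leaf j)) (s (Γ.vert (leaf j)) i)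
      map_add' := fun s s' => by ext j i; exact residue_add _ _ _
      map_smul' := fun c s => by ext j i; exact residue_smul _ _ _ }
  -- The residue theorem on each component and the opposite residues at the nodes make the residues
  -- a balanced family, determined by the leaves.
  have hres : ∀ s ∈ D.dualObstructionSections, ∀ f i, residue (D.pt f) (s (Γ.vert f) i) =
      ∑ j, (Γ.dir f j : ℂ) * ψ₀ s j i := by
    intro s hs f i
    refine TropicalCurve.balanced_eq_sum_dir hemb himg φ hleaf hdir
      (fun f => residue (D.pt f) (s (Γ.vert f) i)) (fun f hf => hs.2.2.1 f hf i) (fun v => ?_) f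
    have h1 := (isLogForm_of_mem_sections hs v i).sum_residue (componentPt_injective hD v)
    have h2 : ∀ f : {f // Γ.vert f = v}, residue (D.componentPt v f) (s v i) =
        residue (D.pt f) (s (Γ.vert f) i) := by
      rintro ⟨f, rfl⟩
      rfl
    simp only [h2] at h1
    rwa [(φ v).sum_subtype (fun f => residue (D.pt f) (s (Γ.vert f) i))] at h1
  have hmaps : ∀ s ∈ D.dualObstructionSections, ψ₀ s ∈ W := by
    intro s hs
    rw [hW]
    intro f
    rw [← sum_residue_mul_dir hD hwt hs f, Finset.sum_comm]
    refine Finset.sum_congr rfl fun i _ => ?_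
    rw [hres s hs, Finset.sum_mul]
    exact Finset.sum_congr rfl fun j _ => by ring
  let ψ : D.dualObstructionSections →ₗ[ℂ] W := ψ₀.restrict hmaps
  have hbij : Function.Bijective ψ := by
    constructor
    · rw [injective_iff_map_eq_zero]
      rintro ⟨s, hs⟩ h0
      have h1 : ψ₀ s = 0 := congrArg Subtype.val h0
      refine Subtype.ext (funext fun v => funext fun i => ?_)
      change s v i = 0
      rw [(isLogForm_of_mem_sections hs v i).eq_sum_eta (componentPt_injective hD v)]
      refine Finset.sum_eq_zero ?_
      rintro ⟨f, rfl⟩ -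
      have h2 := hres s hs f i
      rw [h1] at h2
      simp only [Pi.zero_apply, mul_zero, Finset.sum_const_zero] at h2
      have h3 : residue (D.componentPt (Γ.vert f) ⟨f, rfl⟩) (s (Γ.vert f) i) = 0 := h2
      rw [h3, zero_smul]
    · rintro ⟨R, hR⟩
      refine ⟨⟨componentForms D R, componentForms_mem hD hwt φ ((hW R).mp hR)⟩, ?_⟩
      refine Subtype.ext (funext fun j => funext fun i => ?_)
      refine (residue_componentForms hD φ R (leaf j) i).trans ?_
      simp [hdir, Pi.single_apply]
  exact ⟨LinearEquiv.ofBijective ψ hbij, fun s f i => hres s s.2 f i⟩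

end PreLog

/-! ### The linear conditions on the residues -/

section Conditions

open Filter Topology

variable {n : ℕ} {V F : Type*} [Fintype V] [Fintype F] {Γ : TropicalCurve n V F}
  {d : Fin n → Fin n → ℝ}

/-- The diagonal of a matrix, and its symmetrized sums with weights `a` over the pairs of an
index of the left class of a vertex and an index outside. -/
def conditionMap (φ : ∀ v, Γ.Fork d v) (a : V → Fin n → Fin n → ℂ) :
    (Fin n → Fin n → ℂ) →ₗ[ℂ] (Fin n ⊕ V → ℂ) where
  toFun R := Sum.elim (fun j => R j j)
    fun v => ∑ j ∈ (φ v).K, ∑ i ∈ (φ v).Kᶜ, (R i j + R j i) * a v j i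
  map_add' R R' := by
    ext (j | v)
    · rfl
    · simp only [Sum.elim_inr, Pi.add_apply, ← Finset.sum_add_distrib]
      exact Finset.sum_congr rfl fun j _ => Finset.sum_congr rfl fun i _ => by ring
  map_smul' c R := by
    ext (j | v)
    · rfl
    · simp only [Sum.elim_inr, Pi.smul_apply, smul_eq_mul, RingHom.id_apply, Finset.mul_sum]
      exact Finset.sum_congr rfl fun j _ => Finset.sum_congr rfl fun i _ => by ring

lemma conditionMap_inl (φ : ∀ v, Γ.Fork d v) (a : V → Fin n → Fin n → ℂ)
    (R : Fin n → Fin n → ℂ) (j : Fin n) : conditionMap φ a R (Sum.inl j) = R j j := rfl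

lemma conditionMap_inr (φ : ∀ v, Γ.Fork d v) (a : V → Fin n → Fin n → ℂ)
    (R : Fin n → Fin n → ℂ) (v : V) : conditionMap φ a R (Sum.inr v) =
      ∑ j ∈ (φ v).K, ∑ i ∈ (φ v).Kᶜ, (R i j + R j i) * a v j i := rfl

/-- The limit weights: only the pairs across the two classes of a vertex count. -/
def limitWeight (φ : ∀ v, Γ.Fork d v) (v : V) (_ i : Fin n) : ℂ := if i ∈ (φ v).L then 1 else 0

lemma conditionMap_limitWeight (φ : ∀ v, Γ.Fork d v) (R : Fin n → Fin n → ℂ) (v : V) :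
    conditionMap φ (limitWeight φ) R (Sum.inr v) =
      ∑ j ∈ (φ v).K, ∑ i ∈ (φ v).L, (R i j + R j i) := by
  rw [conditionMap_inr]
  refine Finset.sum_congr rfl fun j _ => ?_
  simp only [limitWeight, mul_ite, mul_one, mul_zero]
  rw [← Finset.sum_filter]
  refine Finset.sum_congr ?_ fun _ _ => rfl
  ext i
  simp only [Finset.mem_filter, Finset.mem_compl, and_iff_right_iff_imp]
  exact fun hi hi' => Finset.disjoint_left.mp (φ v).disjoint hi' hi

/-- A right inverse of `conditionMap φ (limitWeight φ)`. -/
def conditionSection (k l : V → Fin n) : (Fin n ⊕ V → ℂ) →ₗ[ℂ] (Fin n → Fin n → ℂ) where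
  toFun y i j := if i = j then y (Sum.inl i) else
    ∑ v, if i = k v ∧ j = l v then y (Sum.inr v) else 0
  map_add' y y' := by
    ext i j
    simp only [Pi.add_apply]
    split_ifs
    · rfl
    · rw [← Finset.sum_add_distrib]
      exact Finset.sum_congr rfl fun v _ => by split_ifs <;> simp
  map_smul' c y := by
    ext i j
    simp only [Pi.smul_apply, smul_eq_mul, RingHom.id_apply]
    split_ifs
    · rfl
    · rw [Finset.mul_sum]
      exact Finset.sum_congr rfl fun v _ => by split_ifs <;> simp

lemma conditionSection_apply (k l : V → Fin n) (y : Fin n ⊕ V → ℂ) (i j : Fin n) :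
    conditionSection k l y i j = if i = j then y (Sum.inl i) else
      ∑ v, if i = k v ∧ j = l v then y (Sum.inr v) else 0 := rfl

/-- The section places the value for v in the single entry (k v, l v). By `vertex_unique` this entry
is counted at no other vertex, so the conditions do not interfere. -/
lemma conditionMap_conditionSection (hemb : Γ.IsEmbedded) (himg : Γ.image = minTwiceLocus d)
    (hsymm : ∀ i j, d i j = d j i) (φ : ∀ v, Γ.Fork d v) {k l : V → Fin n}
    (hk : ∀ v, k v ∈ (φ v).K) (hl : ∀ v, l v ∈ (φ v).L) (y : Fin n ⊕ V → ℂ) :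
    conditionMap φ (limitWeight φ) (conditionSection k l y) = y := by
  classical
  ext (j | w)
  · simp [conditionMap_inl, conditionSection_apply]
  have hdisj : ∀ i ∈ (φ w).K, i ∉ (φ w).L := fun i hi =>
    Finset.disjoint_left.mp (φ w).disjoint hi
  have h1 : ∀ j ∈ (φ w).K, ∀ i ∈ (φ w).L,
      conditionSection k l y i j + conditionSection k l y j i =
        if j = k w ∧ i = l w then y (Sum.inr w) else 0 := by
    intro j hj i hi
    have hij : i ≠ j := by rintro rfl; exact hdisj i hj hi
    rw [conditionSection_apply, conditionSection_apply, if_neg hij, if_neg hij.symm]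
    have h2 : ∑ v, (if i = k v ∧ j = l v then y (Sum.inr v) else 0) = 0 := by
      refine Finset.sum_eq_zero fun v _ => if_neg ?_
      rintro ⟨rfl, rfl⟩
      have hvw : v = w := TropicalCurve.vertex_unique hemb himg hsymm (φ v) (φ w) (hk v) (hl v)
        (Or.inr ⟨hi, hj⟩)
      subst hvw
      exact hdisj _ (hk v) hi
    rw [h2, zero_add]
    refine Finset.sum_eq_single w (fun v _ hvw => if_neg ?_) (by simp)
    rintro ⟨rfl, rfl⟩
    exact hvw (TropicalCurve.vertex_unique hemb himg hsymm (φ v) (φ w) (hk v) (hl v)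
      (Or.inl ⟨hj, hi⟩))
  rw [conditionMap_limitWeight, Finset.sum_congr rfl fun j hj =>
    Finset.sum_congr rfl fun i hi => h1 j hj i hi, Finset.sum_eq_single (k w),
    Finset.sum_eq_single (l w)]
  · simp
  · intro i _ hi
    simp [hi]
  · exact fun h => absurd (hl w) h
  · intro j _ hj
    simp [hj]
  · exact fun h => absurd (hk w) h

lemma mem_ker_conditionMap_iff (φ : ∀ v, Γ.Fork d v) (a : V → Fin n → Fin n → ℂ)
    (R : Fin n → Fin n → ℂ) : R ∈ LinearMap.ker (conditionMap φ a) ↔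
      (∀ j, R j j = 0) ∧ ∀ v, conditionMap φ a R (Sum.inr v) = 0 := by
  rw [LinearMap.mem_ker, funext_iff, Sum.forall]
  rfl

/-- The weights on the line with the marked points `a`. -/
def lineWeight (k l : V → Fin n) (a : Fin n → ℂ) (v : V) (j i : Fin n) : ℂ :=
  (a (k v) - a (l v)) / (a j - a i)

/-- The condition at v is a nonzero multiple of the sum of the simple residues over the left class.
As their total sum is zero anyway, `eq_zero_of_sum_left_eq_zero` recovers each of them. -/
lemma mem_ker_lineWeight_iff (himg : Γ.image = minTwiceLocus d) (φ : ∀ v, Γ.Fork d v)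
    {leaf : Fin n → F} (hdir : ∀ j, Γ.dir (leaf j) = Pi.single j 1) {k l : V → Fin n}
    (hk : ∀ v, k v ∈ (φ v).K) (hl : ∀ v, l v ∈ (φ v).L) {a : Fin n → ℂ}
    (ha : Function.Injective a) (R : Fin n → Fin n → ℂ) :
    R ∈ LinearMap.ker (conditionMap φ (lineWeight k l a)) ↔
      (∀ j, R j j = 0) ∧ ∀ j, simpleResidue a R j = 0 := by
  rw [mem_ker_conditionMap_iff]
  refine and_congr_right fun _ => ?_
  have h1 : ∀ v, conditionMap φ (lineWeight k l a) R (Sum.inr v) =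
      (a (k v) - a (l v)) * ∑ j ∈ (φ v).K, simpleResidue a R j := by
    intro v
    rw [conditionMap_inr, sum_simpleResidue, Finset.mul_sum]
    refine Finset.sum_congr rfl fun j _ => ?_
    rw [Finset.mul_sum]
    refine Finset.sum_congr rfl fun i _ => ?_
    rw [lineWeight]
    ring
  have h2 : ∀ v, a (k v) - a (l v) ≠ 0 := fun v => sub_ne_zero.mpr (ha.ne fun h =>
    Finset.disjoint_left.mp (φ v).disjoint (hk v) (h ▸ hl v))
  constructor
  · intro h
    refine TropicalCurve.eq_zero_of_sum_left_eq_zero himg φ hdir _ (sum_univ_simpleResidue a R)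
      fun v => ?_
    have := h v
    rw [h1] at this
    exact (mul_eq_zero.mp this).resolve_left (h2 v)
  · intro h v
    rw [h1]
    simp [h]

lemma norm_conditionMap_sub_le (φ : ∀ v, Γ.Fork d v) {a b : V → Fin n → Fin n → ℂ}
    {C : V → Fin n → Fin n → ℝ} {x : ℝ} (hx : 0 ≤ x)
    (h : ∀ v j i, j ∈ (φ v).K → i ∉ (φ v).K → ‖a v j i - b v j i‖ ≤ C v j i * x)
    (R : Fin n → Fin n → ℂ) :
    ‖conditionMap φ a R - conditionMap φ b R‖ ≤
      (∑ v, ∑ j ∈ (φ v).K, ∑ i ∈ (φ v).Kᶜ, ‖R i j + R j i‖ * |C v j i|) * x := by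
  have hnn : ∀ v, 0 ≤ ∑ j ∈ (φ v).K, ∑ i ∈ (φ v).Kᶜ, ‖R i j + R j i‖ * |C v j i| := fun v =>
    Finset.sum_nonneg fun _ _ => Finset.sum_nonneg fun _ _ => by positivity
  have hnn' := Finset.sum_nonneg fun v (_ : v ∈ Finset.univ) => hnn v
  rw [pi_norm_le_iff_of_nonneg (by positivity)]
  rintro (j | v)
  · rw [Pi.sub_apply, conditionMap_inl, conditionMap_inl, sub_self, norm_zero]
    positivity
  · refine le_trans ?_ (mul_le_mul_of_nonneg_right
      (Finset.single_le_sum (fun v _ => hnn v) (Finset.mem_univ v)) hx)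
    rw [Pi.sub_apply, conditionMap_inr, conditionMap_inr, Finset.sum_mul]
    simp only [← Finset.sum_sub_distrib]
    refine (norm_sum_le _ _).trans (Finset.sum_le_sum fun j hj => ?_)
    rw [Finset.sum_mul]
    refine (norm_sum_le _ _).trans (Finset.sum_le_sum fun i hi => ?_)
    rw [← mul_sub, norm_mul, mul_assoc]
    refine mul_le_mul_of_nonneg_left ?_ (norm_nonneg _)
    refine (h v j i hj (by simpa using hi)).trans ?_
    exact mul_le_mul_of_nonneg_right (le_abs_self _) hx

end Conditions
end TropLine

end

/-! ### Assembly of the isomorphisms -/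

open TropLine

theorem proposition5p10 (r : ℕ) (hr : 1 ≤ r)
    (p : Fin (r + 1) → LaurentSeries ℂ) (hp0 : p 0 = 0)
    (hconv : ∀ i, TropLine.Converges (p i))
    (hord : ∀ i j, i < j → TropLine.Prec (p i) (p j))
    {V F : Type*} [Fintype V] [Fintype F]
    (Γ : TropLine.TropicalCurve (r + 1) V F)
    (hΓ3 : Γ.IsTrivalent) (hΓemb : Γ.IsEmbedded) (hΓwt : ∀ f, Γ.wt f = 1)
    (htrop : Γ.image = TropLine.tropLine p)
    (D : TropLine.ToricCurve (r + 1) Γ.toFlagGraph) (hD : D.IsPreLogOfType Γ) :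
    ∃ ε : ℝ, 0 < ε ∧
      ∃ Θ : ∀ t : {t : ℂ // 0 < ‖t‖ ∧ ‖t‖ < ε},
          D.dualObstructionSections ≃ₗ[ℂ]
            (TropLine.lineCurve p (t : ℂ)).dualObstructionSections,
        ∀ s : D.dualObstructionSections, ∃ K : ℝ,
          ∀ (t : {t : ℂ // 0 < ‖t‖ ∧ ‖t‖ < ε}) (f : F) (g : Option (Fin (r + 1))),
            Γ.opp f = f → Γ.dir f = TropLine.starDir r g →
            ∀ i, ‖TropLine.residue ((TropLine.lineCurve p (t : ℂ)).pt g)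
                    ((Θ t s : Unit → Fin (r + 1) → RatFunc ℂ) () i) -
                  TropLine.residue (D.pt f)
                    ((s : V → Fin (r + 1) → RatFunc ℂ) (Γ.vert f) i)‖ ≤ K * ‖(t : ℂ)‖ := by
  have hinj := injective_of_prec hord
  have himg : Γ.image = minTwiceLocus (diffOrder p) := htrop.trans tropLine_eq
  obtain ⟨φ⟩ : Nonempty (∀ v, Γ.Fork (diffOrder p) v) :=
    ⟨fun v => (TropicalCurve.nonempty_fork hΓ3 hΓemb hΓwt himg v).some⟩
  choose leaf hleaf hdir using TropicalCurve.exists_unbounded_flag himg diffOrder_symm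
    (diffOrder_ultrametric hinj) φ
  choose k hk using fun v => (φ v).K_nonempty
  choose l hl using fun v => (φ v).L_nonempty
  have hbound : ∀ v j i, ∃ C, ∀ᶠ t in nhdsWithin (0 : ℂ) {0}ᶜ, j ∈ (φ v).K → i ∉ (φ v).K →
      ‖lineWeight k l (fun i => value (p i) t) v j i - limitWeight φ v j i‖ ≤ C * ‖t‖ := by
    intro v j i
    by_cases h : j ∈ (φ v).K ∧ i ∉ (φ v).K
    · obtain ⟨C, hC⟩ := exists_ratio_bound hconv hinj himg (φ v) (hk v) (hl v) h.1 h.2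
      exact ⟨C, hC.mono fun t ht _ _ => ht⟩
    · exact ⟨0, Filter.Eventually.of_forall fun t h1 h2 => absurd ⟨h1, h2⟩ h⟩
  choose C hC using hbound
  -- One radius serves for distinctness of the marked points and for the finitely many weight
  -- estimates.
  obtain ⟨δ, hδ, hsmall⟩ := eventually_punctured_iff.mp ((eventually_value_ne hconv hinj).and
    (Filter.eventually_all.mpr fun v => Filter.eventually_all.mpr fun j =>
      Filter.eventually_all.mpr fun i => hC v j i))
  obtain ⟨ε, hε, hεδ, Φ, hΦ⟩ := exists_ker_equiv (conditionMap φ (limitWeight φ))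
    (fun t => conditionMap φ (lineWeight k l fun i => value (p i) t)) (conditionSection k l)
    (conditionMap_conditionSection hΓemb himg diffOrder_symm φ hk hl) hδ
    (fun R => ⟨_, fun t h0 h1 => norm_conditionMap_sub_le φ h0.le (hsmall t h0 h1).2 R⟩)
  obtain ⟨Ψ₀, hΨ₀⟩ := exists_sections_equiv hD hΓwt hΓemb himg φ hleaf hdir
    (LinearMap.ker (conditionMap φ (limitWeight φ))) (fun R => by
      rw [TropicalCurve.quadratic_dir_eq_zero_iff himg φ hdir, mem_ker_conditionMap_iff]
      refine and_congr_right fun _ => forall_congr' fun v => ?_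
      rw [conditionMap_limitWeight]
      simp only [add_comm])
  have hline := fun t : {t : ℂ // 0 < ‖t‖ ∧ ‖t‖ < ε} =>
    exists_lineSections_equiv hp0 (hsmall t t.2.1 (t.2.2.trans_le hεδ)).1 _
      (mem_ker_lineWeight_iff himg φ hdir hk hl (hsmall t t.2.1 (t.2.2.trans_le hεδ)).1)
  choose Ψ hΨ using hline
  refine ⟨ε, hε, fun t => Ψ₀.trans ((Φ t).trans (Ψ t)), fun s => ?_⟩
  -- The functional ℓ g i reads off the residue at the marked point g, by the same formula on the
  -- line and on D. So the estimate is closeness to the identity tested on finitely many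
  -- functionals.
  let ℓ : Option (Fin (r + 1)) → Fin (r + 1) → (Fin (r + 1) → Fin (r + 1) → ℂ) →ₗ[ℂ] ℂ :=
    fun g i => ∑ j, (starDir r g j : ℂ) • ((LinearMap.proj i : (Fin (r + 1) → ℂ) →ₗ[ℂ] ℂ) ∘ₗ
      (LinearMap.proj j : (Fin (r + 1) → Fin (r + 1) → ℂ) →ₗ[ℂ] Fin (r + 1) → ℂ))
  have hℓ : ∀ g i R, ℓ g i R = ∑ j, (starDir r g j : ℂ) * R j i := by
    intro g i R
    simp [ℓ]
  have hres : ∀ g i R, lineResidue R i g = ℓ g i R := by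
    rintro (_ | j) i R
    · simp [hℓ, starDir, lineResidue]
    · simp [hℓ, starDir, lineResidue, Pi.single_apply]
  choose K hK using fun g i => hΦ (Ψ₀ s) (ℓ g i)
  refine ⟨∑ g, ∑ i, |K g i|, fun t f g _ hfg i => ?_⟩
  rw [hΨ₀, hfg, ← hℓ]
  refine (le_of_eq ?_).trans ((hK g i t).trans (mul_le_mul_of_nonneg_right ?_ (norm_nonneg _)))
  · rw [LinearEquiv.trans_apply, LinearEquiv.trans_apply, hΨ, hres]
  · refine (le_abs_self _).trans ((Finset.single_le_sum (f := fun i => |K g i|)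
      (fun _ _ => abs_nonneg _) (Finset.mem_univ i)).trans ?_)
    exact Finset.single_le_sum (f := fun g => ∑ i, |K g i|)
      (fun _ _ => Finset.sum_nonneg fun _ _ => abs_nonneg _) (Finset.mem_univ g)
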